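/- Let $A$ be a commutative $C^*$-algebra (not necessarily unital) with spectrum $\widehat A$, and let $H$ be a separable complex Hilbert space. The space $F = C_0(\widehat A, H)$ is a Hilbert $A$-module under the pointwise action of $A\cong C_0(\widehat A)$ and the pointwise inner product $\langle f\,|\,g\rangle(x)=\langle f(x)\,|\,g(x)\rangle_H$. Let $L_A(F)$ be the $C^*$-algebra of adjointable operators on $F$, let $M(A)=L_A(A)$, with $A\subseteq M(A)$ acting on itself by multiplication, and let $M(F)=L_A(A,F)$. A frame of multipliers for $F$ is a sequence $(\beta_i)_{i\in\mathbb N}$ in $M(F)$ with $\langle \xi\,|\,\eta\rangle=\sum_i \langle \xi\,|\,\beta_i\rangle\langle\beta_i\,|\,\eta\rangle$, convergent in the norm of $A$, for all $\xi,\eta\in F$, where $\langle\beta_i\,|\,\eta\rangle=\beta_i^*\eta$ and $\langle\xi\,|\,\beta_i\rangle=(\beta_i^*\xi)^*$. For positive $s\in L_A(F)$, say that $\operatorname{trace}_\beta(s)$ is defined in $A$ if the series $\sum_i \beta_i^* s\beta_i$ converges in the norm of $M(A)$ to an element of $A$. An operator $t\in L_A(F)$ is of trace class if $\operatorname{trace}_\beta(|t|)$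 is defined in $A$ for some frame of multipliers $\beta$ for $F$. For $x\in\widehat A$, the localisation $t_x\in L(H)$ is the operator determined by $(t\xi)(x)=t_x(\xi(x))$ for $\xi\in F$. Let $L^1(H)$ be the space of trace-class operators on $H$ with the norm $\|T\|_1=\operatorname{trace}(|T|)$. **Theorem.** Let $t\in L_A(C_0(\widehat A,H))$. Then $t$ is of trace class if and only if the function $x\mapsto t_x$ lies in $C_0(\widehat A, L^1(H))$, i.e. every $t_x$ is of trace class and $x\mapsto t_x$ is continuous and vanishes at infinity for the trace norm. Moreover the choice of frame is immaterial: for every frame of multipliers $\beta$ for $F$, $\operatorname{trace}_\beta(|t|)$ is defined in $A$ if and only if $x\mapsto t_x$ lies in $C_0(\widehat A,L^1(H))$. -/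

import Mathlib

open Filter Topology
open scoped ZeroAtInfty InnerProductSpace ENNReal

namespace GelfandSpectrum

open WeakDual

variable {A : Type*} [NonUnitalCommCStarAlgebra A]

/-- The character of the unitization of `A` extending a character of `A`. -/
noncomputable def extend (φ : characterSpace ℂ A) : characterSpace ℂ (Unitization ℂ A) :=
  CharacterSpace.equivAlgHom.symm (Unitization.lift (CharacterSpace.toNonUnitalAlgHom φ))

theorem extend_inr (φ : characterSpace ℂ A) (a : A) : extend φ (a : Unitization ℂ A) = φ a := by
  have h : extend φ (a : Unitization ℂ A) =
      Unitization.lift (CharacterSpace.toNonUnitalAlgHom φ) (a : Unitization ℂ A) := rfl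
  rw [h]
  simp

theorem apply_star (φ : characterSpace ℂ A) (a : A) : φ (star a) = star (φ a) := by
  rw [← extend_inr φ, ← extend_inr φ a, Unitization.inr_star, map_star]

theorem norm_apply_le (φ : characterSpace ℂ A) (a : A) : ‖φ a‖ ≤ ‖a‖ := by
  rw [← extend_inr, ← Unitization.norm_inr (𝕜 := ℂ) a]
  exact NonUnitalStarAlgHom.norm_apply_le (extend φ) (a : Unitization ℂ A)

theorem continuous_apply (a : A) : Continuous fun φ : characterSpace ℂ A => φ a :=
  (eval_continuous a).comp continuous_subtype_val

/-- Characters take absolute value at least `ε > 0` at `a` only on a compact set. -/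
theorem isCompact_le_norm (a : A) {ε : ℝ} (hε : 0 < ε) :
    IsCompact {φ : characterSpace ℂ A | ε ≤ ‖φ a‖} := by
  rw [Subtype.isCompact_iff]
  have hS : ((↑) : characterSpace ℂ A → WeakDual ℂ A) '' {φ | ε ≤ ‖φ a‖} =
      (characterSpace ℂ A ∪ {0}) ∩ {φ | ε ≤ ‖φ a‖} := by
    ext φ
    constructor
    · rintro ⟨φ, hφ, rfl⟩
      exact ⟨Or.inl φ.2, hφ⟩
    · rintro ⟨hφ | hφ, h⟩
      · exact ⟨⟨φ, hφ⟩, h, rfl⟩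
      · have h' : ε ≤ ‖φ a‖ := h
        rw [Set.mem_singleton_iff.1 hφ] at h'
        have h0 : (0 : WeakDual ℂ A) a = 0 := rfl
        rw [h0, norm_zero] at h'
        exact absurd h' (not_le.2 hε)
  rw [hS]
  refine (WeakDual.isCompact_closedBall (𝕜 := ℂ) (E := A) 0 1).of_isClosed_subset
    ((CharacterSpace.union_zero_isClosed ℂ A).inter
      (isClosed_le continuous_const (eval_continuous a).norm)) ?_
  rintro φ ⟨hφ, -⟩
  rw [Set.mem_preimage, mem_closedBall_zero_iff]
  refine ContinuousLinearMap.opNorm_le_bound _ zero_le_one fun b => ?_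
  rw [one_mul]
  rcases hφ with hφ | hφ
  · exact norm_apply_le ⟨φ, hφ⟩ b
  · rw [Set.mem_singleton_iff.1 hφ]
    simp

theorem tendsto_apply_cocompact (a : A) :
    Tendsto (fun φ : characterSpace ℂ A => φ a) (cocompact _) (𝓝 0) := by
  rw [Metric.tendsto_nhds]
  intro ε hε
  filter_upwards [(isCompact_le_norm a hε).compl_mem_cocompact] with φ hφ
  simpa using hφ

/-- The Gelfand transform of `a`, as a function vanishing at infinity on the spectrum. -/
noncomputable def transform (a : A) : C₀(characterSpace ℂ A, ℂ) where
  toFun φ := φ a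
  continuous_toFun := continuous_apply a
  zero_at_infty' := tendsto_apply_cocompact a

@[simp]
theorem transform_apply (a : A) (φ : characterSpace ℂ A) : transform a φ = φ a := rfl

variable (A) in
/-- The Gelfand transform as a homomorphism of star algebras. -/
noncomputable def transformHom : A →⋆ₙₐ[ℂ] C₀(characterSpace ℂ A, ℂ) where
  toFun := transform
  map_smul' c a := by ext φ; simp
  map_zero' := by ext φ; simp
  map_add' a b := by ext φ; simp
  map_mul' a b := by ext φ; simp
  map_star' a := by ext φ; simp [apply_star]

/-- The restriction to `A` of a character of the unitization. -/
noncomputable def restrict (ψ : characterSpace ℂ (Unitization ℂ A)) : WeakDual ℂ A :=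
  StrongDual.toWeakDual ((CharacterSpace.toCLM ψ).comp
    (LinearMap.mkContinuous (Unitization.inrHom ℂ ℂ A) 1 fun a => by simp [Unitization.norm_inr]))

theorem restrict_apply (ψ : characterSpace ℂ (Unitization ℂ A)) (a : A) :
    restrict ψ a = ψ (a : Unitization ℂ A) := rfl

theorem continuous_restrict : Continuous (restrict (A := A)) :=
  continuous_of_continuous_eval fun a => by
    simp_rw [restrict_apply]
    exact continuous_apply (a : Unitization ℂ A)

theorem restrict_mem {ψ : characterSpace ℂ (Unitization ℂ A)} (h : restrict ψ ≠ 0) :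
    restrict ψ ∈ characterSpace ℂ A :=
  ⟨h, fun a b => by simp_rw [restrict_apply, Unitization.inr_mul, map_mul]⟩

theorem restrict_extend (φ : characterSpace ℂ A) : restrict (extend φ) = (φ : WeakDual ℂ A) :=
  DFunLike.ext _ _ fun a => extend_inr φ a

theorem transform_injective : Function.Injective (transform (A := A)) := by
  intro a b hab
  have h : (a : Unitization ℂ A) = (b : Unitization ℂ A) := by
    refine (gelfandStarTransform (Unitization ℂ A)).injective (ContinuousMap.ext fun ψ => ?_)
    change ψ (a : Unitization ℂ A) = ψ (b : Unitization ℂ A)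
    rw [← restrict_apply, ← restrict_apply]
    by_cases h0 : restrict ψ = 0
    · rw [h0]; rfl
    · exact DFunLike.congr_fun hab ⟨restrict ψ, restrict_mem h0⟩
  exact Unitization.inr_injective h

open Classical in
/-- The extension by zero of a function on the spectrum to the spectrum of the unitization. -/
noncomputable def extendFun (f : C₀(characterSpace ℂ A, ℂ))
    (ψ : characterSpace ℂ (Unitization ℂ A)) : ℂ :=
  if h : restrict ψ = 0 then 0 else f ⟨restrict ψ, restrict_mem h⟩

theorem continuous_extendFun (f : C₀(characterSpace ℂ A, ℂ)) : Continuous (extendFun f) := by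
  rw [continuous_iff_continuousAt]
  intro ψ
  by_cases h : restrict ψ = 0
  · have h0 : extendFun f ψ = 0 := dif_pos h
    rw [ContinuousAt, h0, Metric.tendsto_nhds]
    intro ε hε
    have hf : ∀ᶠ φ in cocompact (characterSpace ℂ A), dist (f φ) 0 < ε :=
      Metric.tendsto_nhds.1 f.zero_at_infty' ε hε
    obtain ⟨K, hK, hKf⟩ := mem_cocompact.1 hf
    have hK' : IsClosed (((↑) : characterSpace ℂ A → WeakDual ℂ A) '' K) :=
      (hK.image continuous_subtype_val).isClosed
    have hmem : restrict ψ ∈ (((↑) : characterSpace ℂ A → WeakDual ℂ A) '' K)ᶜ := by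
      rintro ⟨φ, -, hφ⟩
      exact φ.2.1 (hφ.trans h)
    filter_upwards [continuous_restrict.continuousAt.eventually (hK'.isOpen_compl.mem_nhds hmem)]
      with χ hχ
    by_cases hχ0 : restrict χ = 0
    · rw [extendFun, dif_pos hχ0, dist_self]
      exact hε
    · rw [extendFun, dif_neg hχ0]
      exact hKf fun hmem' => hχ ⟨_, hmem', rfl⟩
  · have hU : IsOpen {χ : characterSpace ℂ (Unitization ℂ A) | restrict χ ≠ 0} :=
      isOpen_ne_fun continuous_restrict continuous_const
    refine ContinuousOn.continuousAt ?_ (hU.mem_nhds h)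
    rw [continuousOn_iff_continuous_domRestrict]
    have he : Set.domRestrict {χ : characterSpace ℂ (Unitization ℂ A) | restrict χ ≠ 0} (extendFun f)
        = fun χ => f ⟨restrict χ.1, restrict_mem χ.2⟩ := by
      funext χ
      exact dif_neg χ.2
    rw [he]
    exact f.continuous.comp
      ((continuous_restrict.comp continuous_subtype_val).subtype_mk _)

theorem transform_surjective : Function.Surjective (transform (A := A)) := by
  intro f
  obtain ⟨b, hb⟩ := (gelfandStarTransform (Unitization ℂ A)).surjective
    ⟨extendFun f, continuous_extendFun f⟩
  have hb' : ∀ ψ, ψ b = extendFun f ψ := fun ψ => DFunLike.congr_fun hb ψ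
  let ψ₀ : characterSpace ℂ (Unitization ℂ A) :=
    CharacterSpace.equivAlgHom.symm (Unitization.fstHom ℂ A)
  have h₀ : restrict ψ₀ = 0 := DFunLike.ext _ _ fun a => by
    rw [restrict_apply]
    exact Unitization.fst_inr ℂ a
  have hfst : b.fst = 0 := by
    have h1 : ψ₀ b = b.fst := rfl
    rw [← h1, hb', extendFun, dif_pos h₀]
  have hbs : b = (b.snd : Unitization ℂ A) := Unitization.ext (by simp [hfst]) (by simp)
  refine ⟨b.snd, ZeroAtInftyContinuousMap.ext fun φ => ?_⟩
  have hφ : restrict (extend φ) ≠ 0 := by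
    rw [restrict_extend]
    exact φ.2.1
  rw [transform_apply, ← extend_inr, ← hbs, hb', extendFun, dif_neg hφ]
  congr 1
  exact Subtype.ext (restrict_extend φ)

variable (A) in
/-- The Gelfand isomorphism of a commutative C⋆-algebra with the algebra of continuous functions
vanishing at infinity on its spectrum. -/
noncomputable def equiv : A ≃⋆ₐ[ℂ] C₀(characterSpace ℂ A, ℂ) :=
  StarAlgEquiv.ofBijective (transformHom A) ⟨transform_injective, transform_surjective⟩

@[simp]
theorem equiv_apply (a : A) (φ : characterSpace ℂ A) : equiv A a φ = φ a := rfl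

@[simp]
theorem apply_equiv_symm (f : C₀(characterSpace ℂ A, ℂ)) (φ : characterSpace ℂ A) :
    φ ((equiv A).symm f) = f φ := by
  rw [← equiv_apply, StarAlgEquiv.apply_symm_apply]

theorem norm_equiv (a : A) : ‖equiv A a‖ = ‖a‖ :=
  NonUnitalStarAlgHom.norm_map (equiv A) (equiv A).injective a

theorem norm_equiv_symm (f : C₀(characterSpace ℂ A, ℂ)) : ‖(equiv A).symm f‖ = ‖f‖ := by
  rw [← norm_equiv, StarAlgEquiv.apply_symm_apply]

end GelfandSpectrum

namespace HilbertModule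

open WeakDual GelfandSpectrum

section Adjointable

variable (A : Type*) {E F : Type*} [NonUnitalCommCStarAlgebra A] [PartialOrder A]
  [NormedAddCommGroup E] [NormedSpace ℂ E] [SMul A E] [CStarModule A E]
  [NormedAddCommGroup F] [NormedSpace ℂ F] [SMul A F] [CStarModule A F]

/-- `s` is an adjoint of `t` for the `A`-valued inner products. -/
def IsAdjointPair (t : E →L[ℂ] F) (s : F →L[ℂ] E) : Prop :=
  ∀ ξ η, inner A (t ξ) η = inner A ξ (s η)

/-- Adjointable operators between Hilbert `A`-modules. A map with an adjoint is automatically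
`A`-linear, and, the modules being complete, bounded. -/
def IsAdjointable (t : E →L[ℂ] F) : Prop := ∃ s : F →L[ℂ] E, IsAdjointPair A t s

variable {A}

theorem ext_inner {ξ ζ : E} (h : ∀ η : E, inner A η ξ = inner A η ζ) : ξ = ζ := by
  have h' : inner A (ξ - ζ) (ξ - ζ) = 0 := by
    rw [CStarModule.inner_sub_right, h, sub_self]
  exact sub_eq_zero.1 (CStarModule.inner_self.1 h')

theorem IsAdjointPair.unique {t : E →L[ℂ] F} {s s' : F →L[ℂ] E}
    (h : IsAdjointPair A t s) (h' : IsAdjointPair A t s') : s = s' :=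
  ContinuousLinearMap.ext fun η => ext_inner (A := A) fun ξ => by rw [← h, ← h']

theorem IsAdjointPair.symm {t : E →L[ℂ] F} {s : F →L[ℂ] E}
    (h : IsAdjointPair A t s) : IsAdjointPair A s t := fun ξ η => by
  rw [← CStarModule.star_inner, ← h, CStarModule.star_inner]

theorem IsAdjointPair.norm_le [StarOrderedRing A] {t : E →L[ℂ] F} {s : F →L[ℂ] E}
    (h : IsAdjointPair A t s) : ‖s‖ ≤ ‖t‖ := by
  refine s.opNorm_le_bound (norm_nonneg t) fun η => ?_
  rcases (norm_nonneg (s η)).eq_or_lt with h0 | h0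
  · rw [← h0]; positivity
  have h1 : ‖s η‖ ^ 2 ≤ ‖s η‖ * (‖t‖ * ‖η‖) := by
    calc ‖s η‖ ^ 2 = ‖inner A (t (s η)) η‖ := by rw [CStarModule.norm_sq_eq A, h]
      _ ≤ ‖t (s η)‖ * ‖η‖ := CStarModule.norm_inner_le F
      _ ≤ (‖t‖ * ‖s η‖) * ‖η‖ := by gcongr; exact t.le_opNorm _
      _ = ‖s η‖ * (‖t‖ * ‖η‖) := by ring
  rw [sq] at h1
  exact le_of_mul_le_mul_left h1 h0

/-- The adjoint of an adjointable operator. -/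
noncomputable def adjoint {t : E →L[ℂ] F} (ht : IsAdjointable A t) : F →L[ℂ] E := ht.choose

theorem isAdjointPair_adjoint {t : E →L[ℂ] F} (ht : IsAdjointable A t) :
    IsAdjointPair A t (adjoint ht) := ht.choose_spec

variable (A E) in
/-- The algebra of adjointable operators on a Hilbert `A`-module `E`, with the operator norm. -/
def adjointableSubalgebra : Subalgebra ℂ (E →L[ℂ] E) where
  carrier := {t | IsAdjointable A t}
  mul_mem' := by
    rintro t t' ⟨s, hs⟩ ⟨s', hs'⟩
    exact ⟨s' * s, fun ξ η => (hs _ _).trans (hs' _ _)⟩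
  add_mem' := by
    rintro t t' ⟨s, hs⟩ ⟨s', hs'⟩
    refine ⟨s + s', fun ξ η => ?_⟩
    rw [add_apply, add_apply, CStarModule.inner_add_left,
      CStarModule.inner_add_right, hs, hs']
  algebraMap_mem' c := by
    refine ⟨algebraMap ℂ (E →L[ℂ] E) (star c), fun ξ η => ?_⟩
    simp [Algebra.algebraMap_eq_smul_one]

variable (A E) in
/-- The adjointable operators on a Hilbert `A`-module `E`. -/
def AdjointableOp : Type _ := adjointableSubalgebra A E

noncomputable instance : NormedRing (AdjointableOp A E) :=
  inferInstanceAs (NormedRing (adjointableSubalgebra A E))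

noncomputable instance : NormedAlgebra ℂ (AdjointableOp A E) :=
  inferInstanceAs (NormedAlgebra ℂ (adjointableSubalgebra A E))

noncomputable instance : Star (AdjointableOp A E) where
  star t := ⟨adjoint t.2, t.1, (isAdjointPair_adjoint t.2).symm⟩

theorem isAdjointPair_star (t : AdjointableOp A E) : IsAdjointPair A t.1 (star t).1 :=
  isAdjointPair_adjoint t.2

theorem star_eq_of_isAdjointPair {t s : AdjointableOp A E} (h : IsAdjointPair A t.1 s.1) :
    star t = s :=
  Subtype.ext ((isAdjointPair_star t).unique h)

noncomputable instance : StarRing (AdjointableOp A E) where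
  star_involutive t := star_eq_of_isAdjointPair (isAdjointPair_star t).symm
  star_mul t r := star_eq_of_isAdjointPair fun ξ η =>
    (isAdjointPair_star t _ _).trans (isAdjointPair_star r _ _)
  star_add t r := star_eq_of_isAdjointPair fun ξ η => by
    have h1 := isAdjointPair_star t ξ η
    have h2 := isAdjointPair_star r ξ η
    change inner A (t.1 ξ + r.1 ξ) η = inner A ξ ((star t).1 η + (star r).1 η)
    rw [CStarModule.inner_add_left, CStarModule.inner_add_right, h1, h2]

instance : StarModule ℂ (AdjointableOp A E) where
  star_smul c t := star_eq_of_isAdjointPair fun ξ η => by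
    have h1 := isAdjointPair_star t ξ η
    change inner A (c • t.1 ξ) η = inner A ξ (star c • (star t).1 η)
    rw [CStarModule.inner_smul_left_complex, CStarModule.inner_smul_right_complex, h1]

variable [StarOrderedRing A]

theorem norm_star_op (t : AdjointableOp A E) : ‖star t‖ = ‖t‖ :=
  le_antisymm (isAdjointPair_star t).norm_le (isAdjointPair_star t).symm.norm_le

instance : CStarRing (AdjointableOp A E) where
  norm_mul_self_le t := by
    have h : ‖t‖ ≤ √‖star t * t‖ := by
      refine t.1.opNorm_le_bound (Real.sqrt_nonneg _) fun ξ => ?_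
      refine (sq_le_sq₀ (norm_nonneg _) (by positivity)).1 ?_
      rw [mul_pow, Real.sq_sqrt (norm_nonneg _)]
      calc ‖t.1 ξ‖ ^ 2 = ‖inner A ξ ((star t * t).1 ξ)‖ := by
            rw [CStarModule.norm_sq_eq A, isAdjointPair_star t]; rfl
        _ ≤ ‖ξ‖ * ‖(star t * t).1 ξ‖ := CStarModule.norm_inner_le E
        _ ≤ ‖ξ‖ * (‖star t * t‖ * ‖ξ‖) := by gcongr; exact (star t * t).1.le_opNorm ξ
        _ = ‖star t * t‖ * ‖ξ‖ ^ 2 := by ring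
    calc ‖t‖ * ‖t‖ ≤ √‖star t * t‖ * √‖star t * t‖ := by gcongr
      _ = ‖star t * t‖ := Real.mul_self_sqrt (norm_nonneg _)

instance [CompleteSpace E] : CompleteSpace (AdjointableOp A E) := by
  refine Metric.complete_of_cauchySeq_tendsto fun u hu => ?_
  have hu' : CauchySeq fun n => star (u n) := by
    rw [Metric.cauchySeq_iff] at hu ⊢
    intro ε hε
    obtain ⟨N, hN⟩ := hu ε hε
    refine ⟨N, fun m hm n hn => ?_⟩
    have h : star (u m) - star (u n) = star (u m - u n) := (star_sub _ _).symm
    rw [dist_eq_norm, h, norm_star_op, ← dist_eq_norm]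
    exact hN m hm n hn
  obtain ⟨t, ht⟩ := cauchySeq_tendsto_of_complete
    (u := fun n => (u n).1) (hu.map uniformContinuous_subtype_val)
  obtain ⟨s, hs⟩ := cauchySeq_tendsto_of_complete
    (u := fun n => (star (u n)).1) (hu'.map uniformContinuous_subtype_val)
  have hts : IsAdjointPair A t s := fun ξ η => by
    have h1 : Tendsto (fun n => inner A ((u n).1 ξ) η) atTop (𝓝 (inner A (t ξ) η)) :=
      (CStarModule.continuous_inner.tendsto (t ξ, η)).comp
        (((ContinuousLinearMap.apply ℂ E ξ).continuous.tendsto t |>.comp ht).prodMk_nhds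
          tendsto_const_nhds)
    have h2 : Tendsto (fun n => inner A ξ ((star (u n)).1 η)) atTop (𝓝 (inner A ξ (s η))) :=
      (CStarModule.continuous_inner.tendsto (ξ, s η)).comp
        (tendsto_const_nhds.prodMk_nhds
          ((ContinuousLinearMap.apply ℂ E η).continuous.tendsto s |>.comp hs))
    refine tendsto_nhds_unique h1 (h2.congr fun n => ?_)
    exact (isAdjointPair_star (u n) ξ η).symm
  exact ⟨⟨t, s, hts⟩, tendsto_subtype_rng.2 ht⟩

noncomputable instance [CompleteSpace E] : CStarAlgebra (AdjointableOp A E) where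

/-- The absolute value `|t|`, the positive square root of `t* t` in the C⋆-algebra of adjointable
operators. -/
noncomputable def absOp [CompleteSpace E] (t : AdjointableOp A E) : AdjointableOp A E :=
  letI := CStarAlgebra.spectralOrder (AdjointableOp A E)
  haveI := CStarAlgebra.spectralOrderedRing (AdjointableOp A E)
  CFC.abs t

variable (A F) in
/-- The multiplier module of `F`: the adjointable operators from `A` to `F`. -/
abbrev Multiplier : Type _ := {β : A →L[ℂ] F // IsAdjointable A β}

/-- A frame of multipliers: a sequence `β i` of multipliers of `F` such that
`⟪ξ, η⟫ = ∑ i, ⟪ξ, β i⟫ ⟪β i, η⟫` in norm for all `ξ, η` in `F`, where `⟪β i, η⟫` is the value at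
`η` of the adjoint of `β i`. -/
def IsMultiplierFrame (β : ℕ → Multiplier A F) : Prop :=
  ∀ ξ η : F, Tendsto
    (fun n => ∑ i ∈ Finset.range n, star (adjoint (β i).2 ξ) * adjoint (β i).2 η)
    atTop (𝓝 (inner A ξ η))

/-- The multiplier `⟪β, t β⟫ = β* t β` of `A`. -/
noncomputable def multiplierInner (β : Multiplier A F) (t : AdjointableOp A F) : A →L[ℂ] A :=
  adjoint β.2 ∘L t.1 ∘L β.1

/-- The series `∑ i, ⟪β i, t β i⟫` converges, in the norm of the multiplier algebra of `A` (the
operator norm), to the element `a` of `A`, which acts on `A` by multiplication. -/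
def HasTrace (β : ℕ → Multiplier A F) (t : AdjointableOp A F) (a : A) : Prop :=
  Tendsto (fun n => ∑ i ∈ Finset.range n, multiplierInner (β i) t) atTop
    (𝓝 (ContinuousLinearMap.mul ℂ A a))

/-- The trace of `t` relative to the frame `β` is defined in `A`. -/
def TraceDefined (β : ℕ → Multiplier A F) (t : AdjointableOp A F) : Prop :=
  ∃ a : A, HasTrace β t a

/-- `t` is of trace class: the trace of `|t|` is defined in `A`, relative to some frame of
multipliers. -/
def IsTraceClass [CompleteSpace F] (t : AdjointableOp A F) : Prop :=
  ∃ β : ℕ → Multiplier A F, IsMultiplierFrame β ∧ TraceDefined β (absOp t)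

end Adjointable

section FreeModule

variable {A H : Type*} [NonUnitalCommCStarAlgebra A] [NormedAddCommGroup H]
  [InnerProductSpace ℂ H]

variable (A H) in
/-- The space of continuous functions, vanishing at infinity, from the spectrum of `A` to `H`. -/
abbrev FreeModule : Type _ := C₀(characterSpace ℂ A, H)

/-- `A` acts on functions on its spectrum by pointwise multiplication. -/
noncomputable instance : SMul A (FreeModule A H) where
  smul a f :=
    { toFun := fun x => x a • f x
      continuous_toFun := (continuous_apply a).smul f.continuous
      zero_at_infty' := by
        simpa using! (tendsto_apply_cocompact a).smul f.zero_at_infty' }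

theorem freeModule_smul_apply (a : A) (f : FreeModule A H) (x : characterSpace ℂ A) :
    (a • f) x = x a • f x := rfl

/-- The function `x ↦ ⟪f x, g x⟫`. -/
noncomputable def pointwiseInner (f g : FreeModule A H) : C₀(characterSpace ℂ A, ℂ) where
  toFun x := inner ℂ (f x) (g x)
  continuous_toFun := f.continuous.inner g.continuous
  zero_at_infty' := by
    simpa using! Filter.Tendsto.inner (𝕜 := ℂ) f.zero_at_infty' g.zero_at_infty'

/-- The function `x ↦ ‖f x‖`. -/
noncomputable def pointwiseNorm (f : FreeModule A H) : C₀(characterSpace ℂ A, ℂ) where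
  toFun x := (‖f x‖ : ℂ)
  continuous_toFun := Complex.continuous_ofReal.comp f.continuous.norm
  zero_at_infty' := by
    have h := (Complex.continuous_ofReal.tendsto 0).comp (by simpa using! f.zero_at_infty'.norm)
    simpa using! h

theorem pointwiseInner_self (f : FreeModule A H) :
    pointwiseInner f f = star (pointwiseNorm f) * pointwiseNorm f := by
  ext x
  change inner ℂ (f x) (f x) = star (‖f x‖ : ℂ) * (‖f x‖ : ℂ)
  rw [inner_self_eq_norm_sq_to_K]
  simp [sq]

set_option linter.unusedSectionVars false in
theorem norm_pointwiseNorm (f : FreeModule A H) : ‖pointwiseNorm f‖ = ‖f‖ := by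
  refine le_antisymm ?_ ?_
  · refine (BoundedContinuousFunction.norm_le (norm_nonneg f)).2 fun x => ?_
    change ‖(‖f x‖ : ℂ)‖ ≤ ‖f‖
    rw [Complex.norm_real, norm_norm]
    exact f.toBCF.norm_coe_le_norm x
  · refine (BoundedContinuousFunction.norm_le (norm_nonneg _)).2 fun x => ?_
    have h := (pointwiseNorm f).toBCF.norm_coe_le_norm x
    change ‖(‖f x‖ : ℂ)‖ ≤ ‖pointwiseNorm f‖ at h
    rwa [Complex.norm_real, norm_norm] at h

theorem norm_inner_aux (f : FreeModule A H) :
    ‖(equiv A).symm (pointwiseInner f f)‖ = ‖f‖ * ‖f‖ := by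
  have h : ‖star (pointwiseNorm f) * pointwiseNorm f‖ = ‖pointwiseNorm f‖ * ‖pointwiseNorm f‖ :=
    CStarRing.norm_star_mul_self
  rw [norm_equiv_symm, pointwiseInner_self, h, norm_pointwiseNorm]

variable [PartialOrder A] [StarOrderedRing A]

/-- `C₀(Â, H)` is a Hilbert `A`-module, the inner product of `f` and `g` being the element of `A`
whose Gelfand transform is `x ↦ ⟪f x, g x⟫`. -/
noncomputable instance : CStarModule A (FreeModule A H) where
  inner f g := (equiv A).symm (pointwiseInner f g)
  inner_add_right {f g h} := by
    rw [← map_add]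
    congr 1
    ext x
    exact inner_add_right _ _ _
  inner_self_nonneg {f} := by
    rw [pointwiseInner_self, map_mul, map_star]
    exact star_mul_self_nonneg _
  inner_self {f} := by
    rw [← norm_eq_zero, norm_inner_aux, mul_self_eq_zero, norm_eq_zero]
  inner_op_smul_right {a f g} := by
    rw [StarAlgEquiv.symm_apply_eq, map_mul, StarAlgEquiv.apply_symm_apply]
    ext x
    exact inner_smul_right _ _ _
  inner_smul_right_complex {z f g} := by
    rw [← map_smul]
    congr 1
    ext x
    exact inner_smul_right _ _ _
  star_inner f g := by
    rw [← map_star]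
    congr 1
    ext x
    exact inner_conj_symm _ _
  norm_eq_sqrt_norm_inner_self f := by
    rw [norm_inner_aux, Real.sqrt_mul_self (norm_nonneg f)]

theorem apply_inner (f g : FreeModule A H) (x : characterSpace ℂ A) :
    x (inner A f g) = inner ℂ (f x) (g x) := apply_equiv_symm (pointwiseInner f g) x


/-- Evaluation at a point of the spectrum. -/
noncomputable def evalAt (x : characterSpace ℂ A) : FreeModule A H →L[ℂ] H :=
  LinearMap.mkContinuous
    { toFun := fun f => f x
      map_add' := fun _ _ => rfl
      map_smul' := fun _ _ => rfl } 1
    fun f => by simpa using! f.toBCF.norm_coe_le_norm x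

/-- The function `x ↦ x a • v` on the spectrum. -/
noncomputable def tensor (a : A) (v : H) : FreeModule A H where
  toFun x := x a • v
  continuous_toFun := (continuous_apply a).smul continuous_const
  zero_at_infty' := by simpa using! (tendsto_apply_cocompact a).smul_const v

/-- `tensor a v`, as a continuous linear map in `v`. -/
noncomputable def tensorCLM (a : A) : H →L[ℂ] FreeModule A H :=
  LinearMap.mkContinuous
    { toFun := fun v => tensor a v
      map_add' := fun v w => by ext x; exact smul_add _ _ _
      map_smul' := fun c v => by ext x; exact smul_comm _ _ _ } ‖a‖
    fun v => (BoundedContinuousFunction.norm_le (by positivity)).2 fun x => by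
      change ‖x a • v‖ ≤ ‖a‖ * ‖v‖
      rw [norm_smul]
      gcongr
      exact norm_apply_le x a

set_option linter.unusedSectionVars false in
theorem exists_apply_eq_one (x : characterSpace ℂ A) : ∃ a : A, x a = 1 := by
  obtain ⟨b, hb⟩ : ∃ b : A, x b ≠ 0 := by
    by_contra! h
    exact x.2.1 (DFunLike.ext _ _ h)
  exact ⟨(x b)⁻¹ • b, by rw [map_smul, smul_eq_mul, inv_mul_cancel₀ hb]⟩

/-- The localisation `t_x` at a point `x` of the spectrum of an adjointable operator `t` on
`C₀(Â, H)`, as an operator on `H`: apply `t` to a function with value `v` at `x`, and evaluate the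
result at `x`. By `localise_apply` it is the operator with `(t f) x = t_x (f x)` for all `f`; here
`H` is the localisation at `x` of the module, through evaluation at `x`. -/
noncomputable def localise (t : AdjointableOp A (FreeModule A H)) (x : characterSpace ℂ A) :
    H →L[ℂ] H :=
  evalAt x ∘L t.1 ∘L tensorCLM (exists_apply_eq_one x).choose

theorem localise_apply (t : AdjointableOp A (FreeModule A H)) (x : characterSpace ℂ A)
    (f : FreeModule A H) : localise t x (f x) = (t.1 f) x := by
  set g : FreeModule A H := tensor (exists_apply_eq_one x).choose (f x) - f with hg
  have hgx : g x = 0 := by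
    change x (exists_apply_eq_one x).choose • f x - f x = 0
    rw [(exists_apply_eq_one x).choose_spec, one_smul, sub_self]
  have h0 : (t.1 g) x = 0 := by
    rw [← inner_self_eq_zero (𝕜 := ℂ), ← apply_inner, isAdjointPair_star t, apply_inner, hgx,
      inner_zero_left]
  have h1 : (t.1 g) x = localise t x (f x) - (t.1 f) x := by
    rw [hg, map_sub]
    rfl
  exact sub_eq_zero.1 (h1.symm.trans h0)

end FreeModule

section TraceNorm

variable {H : Type*} [NormedAddCommGroup H] [InnerProductSpace ℂ H] [CompleteSpace H]

/-- The sum `∑ i, ⟪e i, T e i⟫` of the diagonal entries of a positive operator `T`. -/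
noncomputable def diagonalSum {ι : Type*} (e : HilbertBasis ι ℂ H) (T : H →L[ℂ] H) : ℝ≥0∞ :=
  ∑' i, ENNReal.ofReal (RCLike.re (inner ℂ (e i) (T (e i))))

set_option linter.unusedSectionVars false in
theorem ofReal_norm_sq_eq_tsum {ι : Type*} (e : HilbertBasis ι ℂ H) (v : H) :
    ENNReal.ofReal (‖v‖ ^ 2) = ∑' i, ENNReal.ofReal (‖inner ℂ (e i) v‖ ^ 2) := by
  have h : HasSum (fun i => ‖inner ℂ (e i) v‖ ^ 2) (‖v‖ ^ 2) := by
    have h2 := Complex.reCLM.hasSum (e.hasSum_inner_mul_inner v v)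
    have h3 : Complex.reCLM (inner ℂ v v) = ‖v‖ ^ 2 := inner_self_eq_norm_sq (𝕜 := ℂ) v
    rw [h3] at h2
    refine h2.congr_fun fun i => ?_
    rw [← inner_conj_symm v (e i), RCLike.conj_mul]
    norm_cast
  rw [← h.tsum_eq, ENNReal.ofReal_tsum_of_nonneg (fun _ => by positivity) h.summable]

theorem diagonalSum_star_mul_self {ι κ : Type*} (e : HilbertBasis ι ℂ H)
    (f : HilbertBasis κ ℂ H) (S : H →L[ℂ] H) :
    diagonalSum e (star S * S) =
      ∑' j, ENNReal.ofReal (‖ContinuousLinearMap.adjoint S (f j)‖ ^ 2) := by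
  have h (v : H) : RCLike.re (inner ℂ v ((star S * S) v)) = ‖S v‖ ^ 2 := by
    have h1 : (star S * S) v = ContinuousLinearMap.adjoint S (S v) := rfl
    rw [h1, ContinuousLinearMap.adjoint_inner_right]
    exact inner_self_eq_norm_sq (𝕜 := ℂ) (S v)
  have h1 : diagonalSum e (star S * S) =
      ∑' i, ∑' j, ENNReal.ofReal (‖inner ℂ (f j) (S (e i))‖ ^ 2) :=
    tsum_congr fun i => by rw [h, ofReal_norm_sq_eq_tsum f]
  rw [h1, ENNReal.tsum_comm]
  refine tsum_congr fun j => ?_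
  rw [ofReal_norm_sq_eq_tsum e]
  refine tsum_congr fun i => ?_
  rw [ContinuousLinearMap.adjoint_inner_right, norm_inner_symm]

/-- The sum of the diagonal entries of a positive operator does not depend on the basis. -/
theorem diagonalSum_eq {ι κ : Type*} (e : HilbertBasis ι ℂ H) (f : HilbertBasis κ ℂ H)
    {T : H →L[ℂ] H} (hT : 0 ≤ T) : diagonalSum e T = diagonalSum f T := by
  obtain ⟨S, rfl⟩ := CStarAlgebra.nonneg_iff_eq_star_mul_self.1 hT
  rw [diagonalSum_star_mul_self e f, diagonalSum_star_mul_self f f]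

variable (H) in
/-- A Hilbert basis of `H`. -/
noncomputable def stdBasis : HilbertBasis (exists_hilbertBasis ℂ H).choose ℂ H :=
  (exists_hilbertBasis ℂ H).choose_spec.choose

/-- The trace norm `trace |T|` of a bounded operator; it is finite exactly if `T` is of trace
class. -/
noncomputable def traceNorm (T : H →L[ℂ] H) : ℝ≥0∞ := diagonalSum (stdBasis H) (CFC.abs T)

/-- `T` lies in `C₀(X, L¹(H))`: its values are trace-class operators, and it is continuous and
vanishes at infinity for the trace norm. -/
structure IsC0TraceClass {X : Type*} [TopologicalSpace X] (T : X → H →L[ℂ] H) : Prop where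
  traceNorm_ne_top : ∀ x, traceNorm (T x) ≠ ∞
  continuous : ∀ x, Tendsto (fun y => traceNorm (T y - T x)) (𝓝 x) (𝓝 0)
  zero_at_infty : Tendsto (fun x => traceNorm (T x)) (cocompact X) (𝓝 0)

end TraceNorm

end HilbertModule

/-! At each point `x` a frame of multipliers evaluates to a Parseval frame `(β i).eval x` of `H`. A
Parseval frame computes the trace of a positive operator just as an orthonormal basis does, so the
partial sums of the trace of `|t|`, read as functions on the spectrum, increase pointwise to the
trace norm of `t_x`, whatever the frame.

If the trace is an element `a` of `A`, then the Gelfand transform of `a` is the function `x ↦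
‖t_x‖₁`, which is therefore finite, continuous and vanishing at infinity. Conversely, if that
function is of this kind, then Dini's theorem makes the partial sums converge uniformly, that is, in
the norm of the multiplier algebra. Both halves are in `IsMultiplierFrame.traceDefined_absOp_iff`.

It remains to pass from continuity of the trace norm to continuity in the trace norm. Since `t` and
`|t|` preserve continuous sections, `t_x` and `|t_x|` vary strongly continuously, and
`tendsto_traceNorm_sub`, a noncommutative analogue of Scheffé's lemma, applies. Its proof tests an
operator against contractions, splits the diagonal into a finite head and a tail, and bounds the
tail by Cauchy–Schwarz. -/

namespace HilbertModule

/-! ### Approximate polar decomposition in a C⋆-algebra -/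

section Polar

variable {B : Type*} [CStarAlgebra B] [PartialOrder B] [StarOrderedRing B]

/-- By the C⋆-identity both squares are the norm of `x* (T* T) x`, because `|T|² = T* T`. -/
theorem norm_mul_eq_norm_abs_mul (T x : B) : ‖T * x‖ = ‖CFC.abs T * x‖ := by
  have h : ‖T * x‖ * ‖T * x‖ = ‖CFC.abs T * x‖ * ‖CFC.abs T * x‖ := by
    rw [← CStarRing.norm_star_mul_self, ← CStarRing.norm_star_mul_self, star_mul, star_mul,
      (CFC.abs_nonneg T).isSelfAdjoint.star_eq, mul_assoc, mul_assoc, ← mul_assoc (star T),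
      ← CFC.abs_mul_abs, mul_assoc]
  exact (mul_self_inj (norm_nonneg _) (norm_nonneg _)).1 h

/-- An approximate polar decomposition, with a contraction in place of the partial isometry. -/
theorem exists_approx_polar (T : B) {ε : ℝ} (hε : 0 < ε) :
    ∃ V : B, ‖V‖ ≤ 1 ∧ ‖star V * T - CFC.abs T‖ ≤ ε ∧ ‖T - V * CFC.abs T‖ ≤ ε := by
  set P := CFC.abs T with hP
  have hP0 : 0 ≤ P := CFC.abs_nonneg T
  have hPsa : IsSelfAdjoint P := hP0.isSelfAdjoint
  have hspec : ∀ x ∈ spectrum ℝ P, 0 ≤ x := fun x hx => spectrum_nonneg_of_nonneg hP0 hx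
  have hcont : ContinuousOn (fun x : ℝ => (x + ε)⁻¹) (spectrum ℝ P) := by
    refine ContinuousOn.inv₀ (by fun_prop) fun x hx => ?_
    have := hspec x hx
    positivity
  -- The contraction will be `T (|T| + ε)⁻¹`. All three bounds then become scalar inequalities on
  -- the spectrum of `|T|`: `x / (x + ε) ≤ 1` and `x - x² / (x + ε) ≤ ε`.
  set R : B := cfc (fun x : ℝ => (x + ε)⁻¹) P with hR
  have hid : cfc (fun x : ℝ => x) P = P := cfc_id' ℝ P
  have hRsa : star R = R := (cfc_predicate (fun x : ℝ => (x + ε)⁻¹) P : IsSelfAdjoint _).star_eq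
  have hPR : P * R = cfc (fun x : ℝ => x * (x + ε)⁻¹) P := by
    conv_lhs => rw [← hid, hR, hid]
    rw [cfc_mul (fun x : ℝ => x) (fun x : ℝ => (x + ε)⁻¹) P (by fun_prop) hcont, hid]
  have hPRP : P * R * P = cfc (fun x : ℝ => x * (x + ε)⁻¹ * x) P := by
    rw [cfc_mul (fun x : ℝ => x * (x + ε)⁻¹) (fun x : ℝ => x) P
      (continuousOn_id.mul hcont) (by fun_prop), hid, hPR]
  have hcomm : R * P = P * R := by
    have h := congrArg star hPR
    rw [star_mul, hRsa, hPsa.star_eq] at h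
    rw [h, (cfc_predicate (fun x : ℝ => x * (x + ε)⁻¹) P : IsSelfAdjoint _).star_eq, ← hPR]
  have hsub : ‖P - P * R * P‖ ≤ ε := by
    have h : P - P * R * P = cfc (fun x : ℝ => x - x * (x + ε)⁻¹ * x) P := by
      rw [cfc_sub (fun x : ℝ => x) (fun x : ℝ => x * (x + ε)⁻¹ * x) P (by fun_prop)
        ((continuousOn_id.mul hcont).mul continuousOn_id), hid, hPRP]
    rw [h]
    refine norm_cfc_le hε.le fun x hx => ?_
    have hx0 := hspec x hx
    have h1 : x - x * (x + ε)⁻¹ * x = ε * (x * (x + ε)⁻¹) := by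
      field_simp
      ring
    have h2 : x * (x + ε)⁻¹ ≤ 1 := by
      rw [← div_eq_mul_inv]
      exact div_le_one_of_le₀ (by linarith) (by positivity)
    rw [h1, Real.norm_of_nonneg (by positivity)]
    exact mul_le_of_le_one_right hε.le h2
  refine ⟨T * R, ?_, ?_, ?_⟩
  · rw [norm_mul_eq_norm_abs_mul, ← hP, hPR]
    refine norm_cfc_le zero_le_one fun x hx => ?_
    have hx0 := hspec x hx
    rw [Real.norm_of_nonneg (by positivity), ← div_eq_mul_inv]
    exact div_le_one_of_le₀ (by linarith) (by positivity)
  · rw [star_mul, hRsa, mul_assoc, ← CFC.abs_mul_abs, ← hP, ← mul_assoc, hcomm, norm_sub_rev]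
    exact hsub
  · have h : T - T * R * P = T * (1 - R * P) := by
      rw [mul_sub, mul_one, mul_assoc]
    rw [h, norm_mul_eq_norm_abs_mul, ← hP, mul_sub, mul_one, ← mul_assoc]
    exact hsub

end Polar

/-! ### Variational description of the trace norm -/

section TraceNorm

variable {H : Type*} [NormedAddCommGroup H] [InnerProductSpace ℂ H]

theorem norm_sum_inner_le_sqrt_mul_sqrt {ι : Type*} (s : Finset ι) (u v : ι → H) :
    ‖∑ i ∈ s, inner ℂ (u i) (v i)‖ ≤ √(∑ i ∈ s, ‖u i‖ ^ 2) * √(∑ i ∈ s, ‖v i‖ ^ 2) := by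
  refine (norm_sum_le _ _).trans ((Finset.sum_le_sum fun i _ => norm_inner_le_norm _ _).trans ?_)
  exact Real.sum_mul_le_sqrt_mul_sqrt s (fun i => ‖u i‖) (fun i => ‖v i‖)

theorem nonneg_re_inner {T : H →L[ℂ] H} (hT : 0 ≤ T) (v : H) :
    0 ≤ RCLike.re (inner ℂ v (T v)) :=
  ((ContinuousLinearMap.nonneg_iff_isPositive T).1 hT).re_inner_nonneg_right v

variable [CompleteSpace H]

theorem re_inner_star_mul_self (S : H →L[ℂ] H) (v : H) :
    RCLike.re (inner ℂ v ((star S * S) v)) = ‖S v‖ ^ 2 := by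
  have h1 : (star S * S) v = ContinuousLinearMap.adjoint S (S v) := rfl
  rw [h1, ContinuousLinearMap.adjoint_inner_right]
  exact inner_self_eq_norm_sq (𝕜 := ℂ) (S v)

omit [CompleteSpace H] in
theorem sum_re_inner_le_diagonalSum {ι : Type*} (e : HilbertBasis ι ℂ H) {T : H →L[ℂ] H}
    (hT : 0 ≤ T) (hfin : diagonalSum e T ≠ ∞) (s : Finset ι) :
    ∑ i ∈ s, RCLike.re (inner ℂ (e i) (T (e i))) ≤ (diagonalSum e T).toReal := by
  rw [← ENNReal.ofReal_le_iff_le_toReal hfin,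
    ENNReal.ofReal_sum_of_nonneg fun i _ => nonneg_re_inner hT _]
  exact ENNReal.sum_le_tsum s

/-- The diagonal entries need not compare one by one. After the cyclic rearrangement into `∑ ‖W* S*
e i‖²` they do, as `W*` is a contraction. -/
theorem diagonalSum_star_mul_self_mul_le {ι : Type*} (e : HilbertBasis ι ℂ H)
    (S W : H →L[ℂ] H) (hW : ‖W‖ ≤ 1) :
    diagonalSum e (star (S * W) * (S * W)) ≤ diagonalSum e (star S * S) := by
  rw [diagonalSum_star_mul_self e e, diagonalSum_star_mul_self e e]
  refine ENNReal.tsum_le_tsum fun i => ENNReal.ofReal_le_ofReal ?_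
  have h : ContinuousLinearMap.adjoint (S * W) (e i) =
      ContinuousLinearMap.adjoint W (ContinuousLinearMap.adjoint S (e i)) := by
    change star (S * W) (e i) = star W (star S (e i))
    rw [star_mul]
    rfl
  rw [h]
  gcongr
  refine (ContinuousLinearMap.le_opNorm _ _).trans (mul_le_of_le_one_left (norm_nonneg _) ?_)
  rwa [LinearIsometryEquiv.norm_map]

/-- Sums of entries `⟪U e i, T e i⟫`, with `U` a contraction, are controlled by the diagonal
of `|T|`. -/
theorem norm_sum_inner_le {T U : H →L[ℂ] H} (hT : traceNorm T ≠ ∞) (hU : ‖U‖ ≤ 1)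
    (s : Finset (exists_hilbertBasis ℂ H).choose) :
    ‖∑ i ∈ s, inner ℂ (U (stdBasis H i)) (T (stdBasis H i))‖ ≤ √(traceNorm T).toReal *
      √(∑ i ∈ s, RCLike.re (inner ℂ (stdBasis H i) (CFC.abs T (stdBasis H i)))) := by
  set e := stdBasis H
  set P := CFC.abs T with hP
  have hP0 : 0 ≤ P := CFC.abs_nonneg T
  set S := CFC.sqrt P
  have hSsa : star S = S := (CFC.sqrt_nonneg P).isSelfAdjoint.star_eq
  have hSS : star S * S = P := by rw [hSsa]; exact CFC.sqrt_mul_sqrt_self P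
  have he (i) : ‖e i‖ = 1 := e.orthonormal.1 i
  -- Replacing `T` by `V |T| = V S²` turns each entry into `⟪S V* U e i, S e i⟫`. Cauchy–Schwarz
  -- over `s` bounds one factor by the full trace and leaves the other as the diagonal of `|T|` over
  -- `s` alone, which is what later makes tails small. The error `s.card * ε` disappears as `ε → 0`.
  have key (ε : ℝ) (hε : 0 < ε) : ‖∑ i ∈ s, inner ℂ (U (e i)) (T (e i))‖ ≤
      √(traceNorm T).toReal * √(∑ i ∈ s, RCLike.re (inner ℂ (e i) (P (e i)))) + s.card * ε := by
    obtain ⟨V, hV, -, hTV⟩ := exists_approx_polar T hε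
    set W : H →L[ℂ] H := star V * U with hW
    have hW1 : ‖W‖ ≤ 1 := by
      refine (norm_mul_le _ _).trans ?_
      rw [norm_star]
      exact mul_le_one₀ hV (norm_nonneg _) hU
    have h1 (i) : inner ℂ (U (e i)) (T (e i)) =
        inner ℂ ((S * W) (e i)) (S (e i)) + inner ℂ (U (e i)) ((T - V * P) (e i)) := by
      have h2 : inner ℂ ((S * W) (e i)) (S (e i)) = inner ℂ (U (e i)) (V (P (e i))) := by
        change inner ℂ (S (ContinuousLinearMap.adjoint V (U (e i)))) (S (e i)) = _
        rw [← ContinuousLinearMap.adjoint_inner_right S, ContinuousLinearMap.adjoint_inner_left,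
          ← hSS]
        rfl
      rw [h2, ← inner_add_right]
      congr 1
      change T (e i) = V (P (e i)) + (T (e i) - V (P (e i)))
      abel
    simp_rw [h1]
    rw [Finset.sum_add_distrib]
    refine (norm_add_le _ _).trans (add_le_add ?_ ?_)
    · refine (norm_sum_inner_le_sqrt_mul_sqrt s _ _).trans ?_
      have hle := diagonalSum_star_mul_self_mul_le e S W hW1
      rw [hSS] at hle
      have h3 : ∑ i ∈ s, ‖(S * W) (e i)‖ ^ 2 ≤ (traceNorm T).toReal := by
        simp_rw [← re_inner_star_mul_self]
        exact (sum_re_inner_le_diagonalSum e (star_mul_self_nonneg _)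
          (ne_top_of_le_ne_top hT hle) s).trans (ENNReal.toReal_mono hT hle)
      have h4 (i) : RCLike.re (inner ℂ (e i) (P (e i))) = ‖S (e i)‖ ^ 2 := by
        rw [← hSS, re_inner_star_mul_self]
      simp_rw [h4]
      gcongr
    · refine (norm_sum_le _ _).trans ((Finset.sum_le_card_nsmul s _ ε fun i _ => ?_).trans_eq
        (nsmul_eq_mul _ _))
      calc ‖inner ℂ (U (e i)) ((T - V * P) (e i))‖
          ≤ ‖U (e i)‖ * ‖(T - V * P) (e i)‖ := norm_inner_le_norm _ _
        _ ≤ (‖U‖ * ‖e i‖) * (‖T - V * P‖ * ‖e i‖) := by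
            gcongr <;> exact ContinuousLinearMap.le_opNorm _ _
        _ ≤ (1 * 1) * (ε * 1) := by rw [he]; gcongr
        _ = ε := by ring
  refine le_of_forall_pos_le_add fun δ hδ => ?_
  refine (key (δ / (s.card + 1)) (by positivity)).trans (add_le_add_right ?_ _)
  rw [mul_div_assoc', div_le_iff₀ (by positivity)]
  nlinarith

/-- With its converse below, this exhibits the trace norm as a supremum of expressions linear in
`T`, over contractions `U` and finite sets `s`. -/
theorem norm_sum_inner_le_traceNorm {T U : H →L[ℂ] H} (hT : traceNorm T ≠ ∞) (hU : ‖U‖ ≤ 1)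
    (s : Finset (exists_hilbertBasis ℂ H).choose) :
    ‖∑ i ∈ s, inner ℂ (U (stdBasis H i)) (T (stdBasis H i))‖ ≤ (traceNorm T).toReal := by
  refine (norm_sum_inner_le hT hU s).trans ?_
  calc _ ≤ √(traceNorm T).toReal * √(traceNorm T).toReal := by
        gcongr
        exact sum_re_inner_le_diagonalSum _ (CFC.abs_nonneg T) hT s
    _ = _ := Real.mul_self_sqrt ENNReal.toReal_nonneg

theorem traceNorm_le_of_forall_norm_sum_inner_le {T : H →L[ℂ] H} {C : ℝ}
    (h : ∀ U : H →L[ℂ] H, ‖U‖ ≤ 1 → ∀ s : Finset (exists_hilbertBasis ℂ H).choose,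
      ‖∑ i ∈ s, inner ℂ (U (stdBasis H i)) (T (stdBasis H i))‖ ≤ C) :
    traceNorm T ≤ ENNReal.ofReal C := by
  rw [traceNorm, diagonalSum, ENNReal.tsum_eq_iSup_sum]
  refine iSup_le fun s => ?_
  set e := stdBasis H
  have he (i) : ‖e i‖ = 1 := e.orthonormal.1 i
  rw [← ENNReal.ofReal_sum_of_nonneg fun i _ => nonneg_re_inner (CFC.abs_nonneg T) _]
  refine ENNReal.ofReal_le_ofReal (le_of_forall_pos_le_add fun δ hδ => ?_)
  -- The near-optimal test contraction is the approximate polar part of `T`. The tolerance makes the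
  -- `s.card` errors add up to at most `δ`, and the `+ 1` covers empty `s`.
  obtain ⟨V, hV, hVT, -⟩ := exists_approx_polar T (ε := δ / (s.card + 1)) (by positivity)
  set ε := δ / (s.card + 1)
  have h1 (i) : RCLike.re (inner ℂ (e i) (CFC.abs T (e i))) ≤
      RCLike.re (inner ℂ (V (e i)) (T (e i))) + ε := by
    have h2 : inner ℂ (V (e i)) (T (e i)) = inner ℂ (e i) (CFC.abs T (e i)) +
        inner ℂ (e i) ((star V * T - CFC.abs T) (e i)) := by
      rw [← inner_add_right, ← ContinuousLinearMap.adjoint_inner_right V]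
      congr 1
      change ContinuousLinearMap.adjoint V (T (e i)) = CFC.abs T (e i) +
        (ContinuousLinearMap.adjoint V (T (e i)) - CFC.abs T (e i))
      abel
    have h3 : ‖inner ℂ (e i) ((star V * T - CFC.abs T) (e i))‖ ≤ ε := by
      refine (norm_inner_le_norm _ _).trans ?_
      rw [he, one_mul]
      refine (ContinuousLinearMap.le_opNorm _ _).trans ?_
      rw [he, mul_one]
      exact hVT
    have h4 := (abs_le.1 ((RCLike.abs_re_le_norm _).trans h3)).1
    rw [h2, map_add]
    linarith
  calc ∑ i ∈ s, RCLike.re (inner ℂ (e i) (CFC.abs T (e i)))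
      ≤ ∑ i ∈ s, (RCLike.re (inner ℂ (V (e i)) (T (e i))) + ε) :=
        Finset.sum_le_sum fun i _ => h1 i
    _ = RCLike.re (∑ i ∈ s, inner ℂ (V (e i)) (T (e i))) + s.card * ε := by
        rw [Finset.sum_add_distrib, map_sum, Finset.sum_const, nsmul_eq_mul]
    _ ≤ C + δ := by
        refine add_le_add ((RCLike.re_le_norm _).trans (h V hV s)) ?_
        rw [mul_div_assoc', div_le_iff₀ (by positivity)]
        nlinarith

/-- In general `|S + T|` is not dominated by `|S| + |T|`, so the inequality comes from the supremum
formula, where it is immediate by linearity. -/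
theorem traceNorm_add_le (S T : H →L[ℂ] H) : traceNorm (S + T) ≤ traceNorm S + traceNorm T := by
  by_cases hS : traceNorm S = ∞
  · simp [hS]
  by_cases hT : traceNorm T = ∞
  · simp [hT]
  rw [← ENNReal.ofReal_toReal hS, ← ENNReal.ofReal_toReal hT,
    ← ENNReal.ofReal_add ENNReal.toReal_nonneg ENNReal.toReal_nonneg]
  refine traceNorm_le_of_forall_norm_sum_inner_le fun U hU s => ?_
  simp_rw [add_apply, inner_add_right]
  rw [Finset.sum_add_distrib]
  exact (norm_add_le _ _).trans (add_le_add (norm_sum_inner_le_traceNorm hS hU s)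
    (norm_sum_inner_le_traceNorm hT hU s))

theorem traceNorm_neg (T : H →L[ℂ] H) : traceNorm (-T) = traceNorm T := by
  rw [traceNorm, CFC.abs_neg, traceNorm]

/-- A sequence `b` with `‖v‖ ^ 2 = ∑ i, |⟪b i, v⟫| ^ 2` computes the trace of positive
operators. -/
theorem tsum_re_inner_eq_diagonalSum {ι κ : Type*} (e : HilbertBasis ι ℂ H) {b : κ → H}
    (hb : ∀ v, HasSum (fun i => ‖inner ℂ (b i) v‖ ^ 2) (‖v‖ ^ 2)) {T : H →L[ℂ] H} (hT : 0 ≤ T) :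
    ∑' i, ENNReal.ofReal (RCLike.re (inner ℂ (b i) (T (b i)))) = diagonalSum e T := by
  -- For `T = S* S` both sides are the double series of `|⟪e j, S (b i)⟫|²`. Its terms are
  -- nonnegative, so it may be summed over `i` first, using the Parseval identity of `b` at `S* e
  -- j`.
  obtain ⟨S, rfl⟩ := CStarAlgebra.nonneg_iff_eq_star_mul_self.1 hT
  rw [diagonalSum_star_mul_self e e]
  simp_rw [re_inner_star_mul_self, ofReal_norm_sq_eq_tsum e (S _)]
  rw [ENNReal.tsum_comm]
  refine tsum_congr fun j => ?_
  rw [← (hb _).tsum_eq, ENNReal.ofReal_tsum_of_nonneg (fun _ => by positivity) (hb _).summable]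
  refine tsum_congr fun i => ?_
  rw [ContinuousLinearMap.adjoint_inner_right, norm_inner_symm]

end TraceNorm

/-! ### From convergence of trace norms to convergence in trace norm -/

section TraceNormConvergence

variable {H : Type*} [NormedAddCommGroup H] [InnerProductSpace ℂ H] [CompleteSpace H]
  {X : Type*} {l : Filter X} {T : X → H →L[ℂ] H} {T₀ : H →L[ℂ] H}

theorem traceNorm_sub_comm (S T : H →L[ℂ] H) : traceNorm (S - T) = traceNorm (T - S) := by
  rw [← traceNorm_neg, neg_sub]

theorem tendsto_traceNorm_of_tendsto_sub (h : Tendsto (fun y => traceNorm (T y - T₀)) l (𝓝 0)) :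
    Tendsto (fun y => traceNorm (T y)) l (𝓝 (traceNorm T₀)) := by
  have h1 : Tendsto (fun y => traceNorm T₀ + traceNorm (T y - T₀)) l (𝓝 (traceNorm T₀)) := by
    simpa using! tendsto_const_nhds.add h
  have h2 : Tendsto (fun y => traceNorm T₀ - traceNorm (T y - T₀)) l (𝓝 (traceNorm T₀)) := by
    simpa using! ENNReal.Tendsto.sub (tendsto_const_nhds (x := traceNorm T₀)) h
      (Or.inr ENNReal.zero_ne_top)
  refine tendsto_of_tendsto_of_tendsto_of_le_of_le h2 h1 (fun y => ?_) fun y => ?_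
  · rw [tsub_le_iff_right]
    have := traceNorm_add_le (T y) (T₀ - T y)
    rwa [add_sub_cancel, traceNorm_sub_comm T₀] at this
  · have := traceNorm_add_le T₀ (T y - T₀)
    rwa [add_sub_cancel] at this

/-- If `n` carries all but `δ` of the trace of `|T|`, then a set disjoint from `n` carries at most
`δ`. The bound does not depend on `U` or `s`. -/
theorem norm_sum_inner_le_of_tail {T U : H →L[ℂ] H} (hT : traceNorm T ≠ ∞) (hU : ‖U‖ ≤ 1)
    {s n : Finset (exists_hilbertBasis ℂ H).choose} (hs : Disjoint s n) {M δ : ℝ}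
    (hM : (traceNorm T).toReal ≤ M)
    (hδ : (traceNorm T).toReal - δ ≤
      ∑ i ∈ n, RCLike.re (inner ℂ (stdBasis H i) (CFC.abs T (stdBasis H i)))) :
    ‖∑ i ∈ s, inner ℂ (U (stdBasis H i)) (T (stdBasis H i))‖ ≤ √M * √δ := by
  refine (norm_sum_inner_le hT hU s).trans ?_
  have h := sum_re_inner_le_diagonalSum (stdBasis H) (CFC.abs_nonneg T) hT (s.disjUnion n hs)
  rw [Finset.sum_disjUnion] at h
  have h' : diagonalSum (stdBasis H) (CFC.abs T) = traceNorm T := rfl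
  rw [h'] at h
  gcongr
  linarith

open Classical in
/-- Strong convergence of operators and of their absolute values, with convergence of the trace
norms, implies convergence in trace norm. -/
theorem tendsto_traceNorm_sub (h₀ : traceNorm T₀ ≠ ∞)
    (hT : ∀ v, Tendsto (fun y => T y v) l (𝓝 (T₀ v)))
    (habs : ∀ v, Tendsto (fun y => CFC.abs (T y) v) l (𝓝 (CFC.abs T₀ v)))
    (htr : Tendsto (fun y => traceNorm (T y)) l (𝓝 (traceNorm T₀))) :
    Tendsto (fun y => traceNorm (T y - T₀)) l (𝓝 0) := by
  have key (ε : ℝ) (hε : 0 < ε) : ∀ᶠ y in l, traceNorm (T y - T₀) ≤ ENNReal.ofReal (3 * ε) := by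
    set τ := (traceNorm T₀).toReal with hτ
    have hτ0 : 0 ≤ τ := ENNReal.toReal_nonneg
    -- Chosen so that `√(τ + 1) * √(2 * δ) = ε`: near the limit, `τ + 1` bounds the trace norm of `T
    -- y` and `2 * δ` bounds its tail.
    set δ : ℝ := ε ^ 2 / (2 * (τ + 1)) with hδdef
    have hδ : 0 < δ := by positivity
    have hMδ : √(τ + 1) * √(2 * δ) = ε := by
      rw [← Real.sqrt_mul (by positivity)]
      have : (τ + 1) * (2 * δ) = ε ^ 2 := by
        rw [hδdef]
        field_simp
      rw [this, Real.sqrt_sq hε.le]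
    set q : (H →L[ℂ] H) → (exists_hilbertBasis ℂ H).choose → ℝ := fun S i =>
      RCLike.re (inner ℂ (stdBasis H i) (CFC.abs S (stdBasis H i))) with hq
    have hsum : HasSum (q T₀) τ := by
      have h1 : ∑' i, ENNReal.ofReal (q T₀ i) ≠ ∞ := h₀
      have h2 := ENNReal.hasSum_toReal h1
      have h3 (i) : (ENNReal.ofReal (q T₀ i)).toReal = q T₀ i :=
        ENNReal.toReal_ofReal (nonneg_re_inner (CFC.abs_nonneg T₀) _)
      simp_rw [h3] at h2
      have h4 : τ = ∑' i, q T₀ i := by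
        rw [hτ, traceNorm, diagonalSum, ENNReal.tsum_toReal_eq fun _ => ENNReal.ofReal_ne_top]
        exact tsum_congr h3
      rwa [h4]
    obtain ⟨n, hn⟩ := (hsum.eventually (lt_mem_nhds (show τ - δ < τ by linarith))).exists
    have hq_tendsto : Tendsto (fun y => ∑ i ∈ n, q (T y) i) l (𝓝 (∑ i ∈ n, q T₀ i)) :=
      tendsto_finsetSum _ fun i _ => (RCLike.continuous_re.tendsto _).comp
        (tendsto_const_nhds.inner (habs _))
    have hfin_tendsto : Tendsto (fun y => ∑ i ∈ n, ‖T y (stdBasis H i) - T₀ (stdBasis H i)‖) l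
        (𝓝 0) := by
      have : Tendsto (fun y => ∑ i ∈ n, ‖T y (stdBasis H i) - T₀ (stdBasis H i)‖) l
          (𝓝 (∑ i ∈ n, (0 : ℝ))) :=
        tendsto_finsetSum _ fun i _ => tendsto_iff_norm_sub_tendsto_zero.1 (hT _)
      simpa using this
    have htr' := (ENNReal.tendsto_toReal h₀).comp htr
    filter_upwards [hq_tendsto.eventually (lt_mem_nhds hn),
      hfin_tendsto.eventually (gt_mem_nhds hε), htr.eventually (gt_mem_nhds h₀.lt_top),
      htr'.eventually (gt_mem_nhds (show τ < τ + 1 by linarith)),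
      htr'.eventually (gt_mem_nhds (show τ < τ + δ by linarith))] with y h1 h2 h3 h4 h5
    refine traceNorm_le_of_forall_norm_sum_inner_le fun U hU s => ?_
    rw [← Finset.sum_inter_add_sum_sdiff s n]
    have hdisj : Disjoint (s \ n) n := Finset.sdiff_disjoint
    -- The trace of `|T y|` is below `τ + δ`, while its part over `n` exceeds `τ - δ`, so at most `2
    -- * δ` lies outside `n`. The two tails and the head contribute `ε` each.
    have htail1 := norm_sum_inner_le_of_tail (M := τ + 1) (δ := 2 * δ) h3.ne hU hdisj h4.le
      (by have h5' : (traceNorm (T y)).toReal < τ + δ := h5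
          exact le_trans (by linarith) h1.le)
    have htail2 := norm_sum_inner_le_of_tail (M := τ + 1) (δ := 2 * δ) h₀ hU hdisj
      (by linarith) (le_trans (by linarith) hn.le)
    rw [hMδ] at htail1 htail2
    have hhead : ‖∑ i ∈ s ∩ n, inner ℂ (U (stdBasis H i)) ((T y - T₀) (stdBasis H i))‖ ≤ ε := by
      refine (norm_sum_le _ _).trans (le_trans ?_ h2.le)
      refine (Finset.sum_le_sum fun i _ => ?_).trans
        (Finset.sum_le_sum_of_subset_of_nonneg Finset.inter_subset_right
          fun i _ _ => norm_nonneg (T y (stdBasis H i) - T₀ (stdBasis H i)))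
      refine (norm_inner_le_norm _ _).trans (mul_le_of_le_one_left (norm_nonneg _) ?_)
      refine (U.le_opNorm _).trans ?_
      rw [(stdBasis H).orthonormal.1 i, mul_one]
      exact hU
    refine (norm_add_le _ _).trans ?_
    have hsub : ‖∑ i ∈ s \ n, inner ℂ (U (stdBasis H i)) ((T y - T₀) (stdBasis H i))‖ ≤ ε + ε := by
      simp_rw [sub_apply, inner_sub_right]
      rw [Finset.sum_sub_distrib]
      exact (norm_sub_le _ _).trans (add_le_add htail1 htail2)
    linarith
  rw [ENNReal.tendsto_nhds_zero]
  intro ε hε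
  obtain ⟨r, hr0, hr⟩ := ENNReal.lt_iff_exists_real_btwn.1 hε
  have hr1 : 0 < r := ENNReal.ofReal_pos.1 hr.1
  filter_upwards [key (r / 3) (by positivity)] with y hy
  refine hy.trans ?_
  rw [mul_div_cancel₀ _ (by norm_num)]
  exact hr.2.le

end TraceNormConvergence

/-! ### Localisation as a ⋆-homomorphism and its strong continuity -/

section Localisation

open WeakDual GelfandSpectrum

variable {A H : Type*} [NonUnitalCommCStarAlgebra A] [PartialOrder A] [StarOrderedRing A]
  [NormedAddCommGroup H] [InnerProductSpace ℂ H]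

theorem exists_freeModule_apply_eq (x : characterSpace ℂ A) (v : H) :
    ∃ f : FreeModule A H, f x = v :=
  ⟨tensor (exists_apply_eq_one x).choose v, by
    change x (exists_apply_eq_one x).choose • v = v
    rw [(exists_apply_eq_one x).choose_spec, one_smul]⟩

theorem localise_mul (s t : AdjointableOp A (FreeModule A H)) (x : characterSpace ℂ A) :
    localise (s * t) x = localise s x * localise t x := by
  ext v
  obtain ⟨f, rfl⟩ := exists_freeModule_apply_eq x v
  rw [localise_apply]
  change _ = localise s x (localise t x (f x))
  rw [localise_apply, localise_apply]
  rfl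

/-- Constants need not vanish at infinity, so continuity is tested locally: near `x` one may divide
by an element `c` of `A` with `x c = 1`. -/
theorem continuous_of_continuous_apply_smul {V : Type*} [NormedAddCommGroup V] [NormedSpace ℂ V]
    {f : characterSpace ℂ A → V} (h : ∀ c : A, Continuous fun x => x c • f x) :
    Continuous f := by
  rw [continuous_iff_continuousAt]
  intro x
  obtain ⟨c, hc⟩ := exists_apply_eq_one x
  have hc0 : x c ≠ 0 := by rw [hc]; exact one_ne_zero
  have hcx : ContinuousAt (fun y : characterSpace ℂ A => y c) x :=
    (continuous_apply c).continuousAt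
  have h1 : ContinuousAt (fun y : characterSpace ℂ A => (y c)⁻¹ • (y c • f y)) x :=
    (hcx.inv₀ hc0).smul (h c).continuousAt
  refine h1.congr ?_
  filter_upwards [hcx.eventually_ne hc0] with y hy
  rw [smul_smul, inv_mul_cancel₀ hy, one_smul]

theorem continuous_localise_apply (t : AdjointableOp A (FreeModule A H)) (v : H) :
    Continuous fun x => localise t x v :=
  continuous_of_continuous_apply_smul fun c => by
    have h : (fun x : characterSpace ℂ A => x c • localise t x v) = t.1 (tensor c v) := by
      funext x
      rw [← localise_apply, ← map_smul]
      rfl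
    rw [h]
    exact (t.1 (tensor c v)).continuous

variable [CompleteSpace H]

theorem localise_star (t : AdjointableOp A (FreeModule A H)) (x : characterSpace ℂ A) :
    localise (star t) x = star (localise t x) := by
  refine (ContinuousLinearMap.eq_adjoint_iff _ _).2 fun v w => ?_
  obtain ⟨f, rfl⟩ := exists_freeModule_apply_eq x v
  obtain ⟨g, rfl⟩ := exists_freeModule_apply_eq x w
  rw [localise_apply, localise_apply, ← apply_inner, ← apply_inner,
    (isAdjointPair_star t).symm]

/-- Localisation is multiplicative and preserves adjoints, so it sends `|t|` to a positive square
root of `t_x* t_x`, and such a root is unique. -/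
theorem localise_absOp (t : AdjointableOp A (FreeModule A H)) (x : characterSpace ℂ A) :
    localise (absOp t) x = CFC.abs (localise t x) := by
  let _ := CStarAlgebra.spectralOrder (AdjointableOp A (FreeModule A H))
  have _ := CStarAlgebra.spectralOrderedRing (AdjointableOp A (FreeModule A H))
  have habs : absOp t * absOp t = star t * t := CFC.abs_mul_abs t
  obtain ⟨r, hr⟩ := CStarAlgebra.nonneg_iff_eq_star_mul_self.1 (CFC.abs_nonneg t)
  have hr' : absOp t = star r * r := hr
  have h0 : 0 ≤ localise (absOp t) x := by
    rw [hr', localise_mul, localise_star]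
    exact star_mul_self_nonneg _
  symm
  refine CFC.sqrt_unique ?_ h0
  rw [← localise_mul, habs, localise_mul, localise_star]

end Localisation

/-! ### Multipliers as functions on the spectrum, and Dini's theorem -/

section Frames

open WeakDual GelfandSpectrum

variable {A H : Type*} [NonUnitalCommCStarAlgebra A] [PartialOrder A] [StarOrderedRing A]
  [NormedAddCommGroup H] [InnerProductSpace ℂ H]

/-- The value at `x` of a multiplier `β` of `C₀(Â, H)`, regarded as a function on the spectrum:
`β c` is the function `x ↦ x c • β.eval x`. -/
noncomputable def Multiplier.eval (β : Multiplier A (FreeModule A H)) (x : characterSpace ℂ A) :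
    H := β.1 (exists_apply_eq_one x).choose x

theorem apply_adjoint_multiplier (β : Multiplier A (FreeModule A H)) (x : characterSpace ℂ A)
    (ξ : FreeModule A H) : x (adjoint β.2 ξ) = inner ℂ (β.eval x) (ξ x) := by
  have h := isAdjointPair_adjoint β.2 (exists_apply_eq_one x).choose ξ
  have h1 := congrArg x h
  have h2 : inner A (exists_apply_eq_one x).choose (adjoint β.2 ξ) =
    adjoint β.2 ξ * star (exists_apply_eq_one x).choose := rfl
  rw [apply_inner, h2, map_mul, apply_star, (exists_apply_eq_one x).choose_spec, star_one,
    mul_one] at h1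
  exact h1.symm

/-- Shows that the choice made in `Multiplier.eval` is immaterial. It is proved by pairing with
arbitrary vectors, each the value at `x` of some `ξ`, and moving `β` to its adjoint. -/
theorem multiplier_apply (β : Multiplier A (FreeModule A H)) (c : A) (x : characterSpace ℂ A) :
    β.1 c x = x c • β.eval x := by
  refine ext_inner_right ℂ fun v => ?_
  obtain ⟨ξ, rfl⟩ := exists_freeModule_apply_eq x v
  have h2 : inner A c (adjoint β.2 ξ) = adjoint β.2 ξ * star c := rfl
  rw [inner_smul_left, ← apply_inner, isAdjointPair_adjoint β.2, h2, map_mul, apply_star,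
    apply_adjoint_multiplier, mul_comm]
  rfl

theorem apply_multiplierInner (β : Multiplier A (FreeModule A H))
    (s : AdjointableOp A (FreeModule A H)) (c : A) (x : characterSpace ℂ A) :
    x (multiplierInner β s c) = x c * inner ℂ (β.eval x) (localise s x (β.eval x)) := by
  change x (adjoint β.2 (s.1 (β.1 c))) = _
  rw [apply_adjoint_multiplier, ← localise_apply, multiplier_apply, map_smul, inner_smul_right]

theorem continuous_inner_localise (β : Multiplier A (FreeModule A H))
    (s : AdjointableOp A (FreeModule A H)) :
    Continuous fun x => inner ℂ (β.eval x) (localise s x (β.eval x)) :=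
  continuous_of_continuous_apply_smul fun c => by
    simp_rw [smul_eq_mul, ← apply_multiplierInner]
    exact continuous_apply _

/-- The frame identity at `ξ = η`, evaluated at `x`. This pointwise Parseval property is all that
the rest of the proof uses about a frame. -/
theorem IsMultiplierFrame.hasSum {β : ℕ → Multiplier A (FreeModule A H)}
    (hβ : IsMultiplierFrame β) (x : characterSpace ℂ A) (v : H) :
    HasSum (fun i => ‖inner ℂ ((β i).eval x) v‖ ^ 2) (‖v‖ ^ 2) := by
  obtain ⟨ξ, rfl⟩ := exists_freeModule_apply_eq x v
  rw [hasSum_iff_tendsto_nat_of_nonneg fun i => by positivity]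
  have h := (Complex.continuous_re.tendsto _).comp
    (((map_continuous (x : characterSpace ℂ A)).tendsto _).comp (hβ ξ ξ))
  have h1 : (x (inner A ξ ξ)).re = ‖ξ x‖ ^ 2 := by
    rw [apply_inner]
    exact inner_self_eq_norm_sq (𝕜 := ℂ) _
  rw [h1] at h
  refine h.congr fun n => ?_
  simp only [Function.comp_apply, map_sum, map_mul, apply_star, apply_adjoint_multiplier,
    Complex.re_sum]
  refine Finset.sum_congr rfl fun i _ => ?_
  rw [mul_comm, Complex.star_def, Complex.mul_conj, Complex.normSq_eq_norm_sq, Complex.ofReal_re]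

/-- A version of Dini's theorem on the whole of a space, for a limit vanishing at infinity. -/
theorem eventually_forall_sub_le {X : Type*} [TopologicalSpace X] {F : ℕ → X → ℝ} {f : X → ℝ}
    (hF : ∀ n, Continuous (F n)) (hF0 : ∀ n x, 0 ≤ F n x) (hmono : Monotone F)
    (hf : Continuous f) (hf0 : Tendsto f (cocompact X) (𝓝 0))
    (hlim : ∀ x, Tendsto (fun n => F n x) atTop (𝓝 (f x))) {ε : ℝ} (hε : 0 < ε) :
    ∀ᶠ n in atTop, ∀ x, |F n x - f x| ≤ ε := by
  -- Off the compact set `K` the bounds `0 ≤ F n ≤ f < ε` hold for every `n`, so Dini's theorem is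
  -- needed on `K` only.
  obtain ⟨K, hK, hKf⟩ := mem_cocompact.1 (hf0.eventually (gt_mem_nhds hε))
  have hle (n x) : F n x ≤ f x :=
    ge_of_tendsto (hlim x) (eventually_atTop.2 ⟨n, fun m hm => hmono hm x⟩)
  have hu := (tendstoLocallyUniformlyOn_iff_tendstoUniformlyOn_of_compact hK).1
    (hmono.tendstoLocallyUniformly_of_forall_tendsto hF hf hlim).tendstoLocallyUniformlyOn
  filter_upwards [Metric.tendstoUniformlyOn_iff.1 hu ε hε] with n hn x
  by_cases hx : x ∈ K
  · rw [abs_sub_comm]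
    exact (hn x hx).le
  · have h1 : f x < ε := hKf hx
    rw [abs_sub_comm, abs_of_nonneg (sub_nonneg.2 (hle n x))]
    linarith [hF0 n x]

omit [PartialOrder A] [StarOrderedRing A] in
/-- An element of `A` with prescribed Gelfand transform. -/
theorem exists_apply_eq_ofReal {f : characterSpace ℂ A → ℝ} (hf : Continuous f)
    (hf0 : Tendsto f (cocompact _) (𝓝 0)) : ∃ a : A, ∀ x : characterSpace ℂ A, x a = f x := by
  let g : C₀(characterSpace ℂ A, ℂ) :=
    { toFun := fun x => f x
      continuous_toFun := Complex.continuous_ofReal.comp hf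
      zero_at_infty' := by simpa using! (Complex.continuous_ofReal.tendsto 0).comp hf0 }
  exact ⟨(equiv A).symm g, fun x => apply_equiv_symm g x⟩

omit [PartialOrder A] [StarOrderedRing A] in
theorem norm_le_of_forall_apply_le {a : A} {C : ℝ} (hC : 0 ≤ C)
    (h : ∀ x : characterSpace ℂ A, ‖x a‖ ≤ C) : ‖a‖ ≤ C := by
  rw [← norm_equiv]
  exact (BoundedContinuousFunction.norm_le hC).2 h

end Frames

/-! ### Existence of a frame of constant multipliers -/

section ExistsFrame

open WeakDual GelfandSpectrum

variable {A H : Type*} [NonUnitalCommCStarAlgebra A] [PartialOrder A] [StarOrderedRing A]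
  [NormedAddCommGroup H] [InnerProductSpace ℂ H]

omit [PartialOrder A] [StarOrderedRing A] in
theorem ext_apply {a b : A} (h : ∀ x : characterSpace ℂ A, x a = x b) : a = b :=
  (equiv A).injective (ZeroAtInftyContinuousMap.ext h)

/-- `tensor a v`, as a continuous linear map in `a`. -/
noncomputable def tensorLeft (v : H) : A →L[ℂ] FreeModule A H :=
  LinearMap.mkContinuous
    { toFun := fun a => tensor a v
      map_add' := fun a b => by
        ext x
        change x (a + b) • v = x a • v + x b • v
        rw [map_add, add_smul]
      map_smul' := fun c a => by
        ext x
        change x (c • a) • v = c • x a • v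
        rw [map_smul, smul_assoc] } ‖v‖
    fun a => (BoundedContinuousFunction.norm_le (by positivity)).2 fun x => by
      change ‖x a • v‖ ≤ ‖v‖ * ‖a‖
      rw [norm_smul, mul_comm]
      gcongr
      exact norm_apply_le x a

/-- The function `x ↦ ⟪v, f x⟫`. -/
noncomputable def innerConst (v : H) (f : FreeModule A H) : C₀(characterSpace ℂ A, ℂ) where
  toFun x := inner ℂ v (f x)
  continuous_toFun := continuous_const.inner f.continuous
  zero_at_infty' := by
    simpa using! Filter.Tendsto.inner (𝕜 := ℂ) (tendsto_const_nhds (x := v)) f.zero_at_infty'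

omit [PartialOrder A] [StarOrderedRing A] in
theorem apply_equiv_symm_innerConst (v : H) (f : FreeModule A H) (x : characterSpace ℂ A) :
    x ((equiv A).symm (innerConst v f)) = inner ℂ v (f x) :=
  apply_equiv_symm _ x

/-- The adjoint of `tensorLeft v`. -/
noncomputable def innerLeft (v : H) : FreeModule A H →L[ℂ] A :=
  LinearMap.mkContinuous
    { toFun := fun f => (equiv A).symm (innerConst v f)
      map_add' := fun f g => ext_apply fun x => by
        simp only [map_add, apply_equiv_symm_innerConst]
        exact inner_add_right _ _ _
      map_smul' := fun c f => ext_apply fun x => by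
        simp only [map_smul, apply_equiv_symm_innerConst, RingHom.id_apply, smul_eq_mul]
        exact inner_smul_right _ _ _ } ‖v‖
    fun f => norm_le_of_forall_apply_le (by positivity) fun x => by
      refine (congrArg norm (apply_equiv_symm_innerConst v f x)).trans_le ?_
      refine (norm_inner_le_norm _ _).trans ?_
      gcongr
      exact f.toBCF.norm_coe_le_norm x

omit [PartialOrder A] [StarOrderedRing A] in
theorem apply_innerLeft (v : H) (f : FreeModule A H) (x : characterSpace ℂ A) :
    x (innerLeft v f) = inner ℂ v (f x) :=
  apply_equiv_symm_innerConst v f x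

theorem isAdjointPair_tensorLeft (v : H) :
    IsAdjointPair A (tensorLeft v : A →L[ℂ] FreeModule A H) (innerLeft v) := fun a f =>
  ext_apply fun x => by
    have h : inner A a (innerLeft v f) = innerLeft v f * star a := rfl
    rw [apply_inner, h, map_mul, apply_star, apply_innerLeft]
    change inner ℂ (x a • v) (f x) = _
    rw [inner_smul_left, mul_comm]
    rfl

/-- The constant multiplier of `C₀(Â, H)` with value `v`. -/
noncomputable def constMultiplier (v : H) : Multiplier A (FreeModule A H) :=
  ⟨tensorLeft v, innerLeft v, isAdjointPair_tensorLeft v⟩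

/-- `adjoint` is obtained by choice; its explicit form here follows from uniqueness of adjoints. -/
theorem adjoint_constMultiplier (v : H) :
    adjoint (constMultiplier (A := A) v).2 = innerLeft v :=
  (isAdjointPair_adjoint _).unique (isAdjointPair_tensorLeft v)

/-- The error is `-⟪v, w - p⟫` with `p` the partial expansion of `w`. It is thus controlled by the
Parseval defect of `w` alone, which is monotone in `n` and so accessible to Dini's theorem. -/
theorem norm_sum_inner_mul_inner_sub_inner_le {b : ℕ → H} {n : ℕ} (v w : H)
    (hb : ∀ v, ‖v - ∑ i ∈ Finset.range n, inner ℂ (b i) v • b i‖ ^ 2 =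
      ‖v‖ ^ 2 - ∑ i ∈ Finset.range n, ‖inner ℂ (b i) v‖ ^ 2) :
    ‖∑ i ∈ Finset.range n, inner ℂ v (b i) * inner ℂ (b i) w - inner ℂ v w‖ ≤
      ‖v‖ * √(‖w‖ ^ 2 - ∑ i ∈ Finset.range n, ‖inner ℂ (b i) w‖ ^ 2) := by
  have h : ∑ i ∈ Finset.range n, inner ℂ v (b i) * inner ℂ (b i) w - inner ℂ v w =
      -inner ℂ v (w - ∑ i ∈ Finset.range n, inner ℂ (b i) w • b i) := by
    rw [inner_sub_right, inner_sum, neg_sub]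
    congr 1
    exact Finset.sum_congr rfl fun i _ => by rw [inner_smul_right, mul_comm]
  rw [h, norm_neg, ← hb, Real.sqrt_sq (norm_nonneg _)]
  exact norm_inner_le_norm _ _

/-- A Hilbert basis of a separable space, padded by zeros to a sequence. -/
theorem exists_orthogonal_seq [CompleteSpace H] [TopologicalSpace.SeparableSpace H] :
    ∃ b : ℕ → H, (∀ v, HasSum (fun i => ‖inner ℂ (b i) v‖ ^ 2) (‖v‖ ^ 2)) ∧
      ∀ n v, ‖v - ∑ i ∈ Finset.range n, inner ℂ (b i) v • b i‖ ^ 2 =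
        ‖v‖ ^ 2 - ∑ i ∈ Finset.range n, ‖inner ℂ (b i) v‖ ^ 2 := by
  set e := stdBasis H
  have he := e.orthonormal
  have hcount : Countable (exists_hilbertBasis ℂ H).choose := by
    rw [← Set.countable_univ_iff]
    -- Distinct basis vectors are at distance `√2 > 1`, so balls of radius `1 / 2` around them are
    -- disjoint open sets, countably many in a separable space.
    refine Set.PairwiseDisjoint.countable_of_isOpen (s := fun i => Metric.ball (e i) (1 / 2))
      (fun i _ j _ hij => ?_) (fun _ _ => Metric.isOpen_ball)
      fun _ _ => Metric.nonempty_ball.2 (by norm_num)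
    refine Metric.ball_disjoint_ball ?_
    have h2 := norm_sub_sq (𝕜 := ℂ) (e i) (e j)
    rw [he.2 hij, he.1, he.1, map_zero] at h2
    rw [dist_eq_norm]
    nlinarith [norm_nonneg (e i - e j)]
  have := Encodable.ofCountable (exists_hilbertBasis ℂ H).choose
  have hinj := Encodable.encode_injective (α := (exists_hilbertBasis ℂ H).choose)
  let b : ℕ → H := Function.extend Encodable.encode e 0
  have hbe (i) : b (Encodable.encode i) = e i := hinj.extend_apply _ _ _
  have hb0 {n : ℕ} (hn : n ∉ Set.range (Encodable.encode (α := (exists_hilbertBasis ℂ H).choose))) :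
      b n = 0 := Function.extend_apply' _ _ _ hn
  -- The factor `⟪b i, v⟫` lets the relation hold also for the padding vectors, where `⟪b i, b i⟫`
  -- is `0` and not `1`.
  have horth (i j : ℕ) (v : H) : inner ℂ (b i) v * inner ℂ (b j) (b i) =
      if i = j then inner ℂ (b i) v else 0 := by
    by_cases hi : i ∈ Set.range (Encodable.encode (α := (exists_hilbertBasis ℂ H).choose))
    · by_cases hj : j ∈ Set.range (Encodable.encode (α := (exists_hilbertBasis ℂ H).choose))
      · obtain ⟨i, rfl⟩ := hi
        obtain ⟨j, rfl⟩ := hj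
        rw [hbe, hbe]
        split_ifs with hij
        · rw [hinj hij, inner_self_eq_norm_sq_to_K, he.1]
          simp
        · rw [he.2 fun h => hij (congrArg _ h.symm), mul_zero]
      · rw [hb0 hj, inner_zero_left, mul_zero, if_neg]
        rintro rfl
        exact hj hi
    · simp [hb0 hi]
  refine ⟨b, fun v => ?_, fun n v => ?_⟩
  · rw [← hinj.hasSum_iff fun n hn => by simp [hb0 hn]]
    have h2 := Complex.reCLM.hasSum (e.hasSum_inner_mul_inner v v)
    have h3 : Complex.reCLM (inner ℂ v v) = ‖v‖ ^ 2 := inner_self_eq_norm_sq (𝕜 := ℂ) v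
    rw [h3] at h2
    refine h2.congr_fun fun i => ?_
    simp only [Function.comp_apply, hbe]
    rw [← inner_conj_symm v (e i), RCLike.conj_mul]
    norm_cast
  · set p := ∑ i ∈ Finset.range n, inner ℂ (b i) v • b i with hp
    have hbp (j) (hj : j ∈ Finset.range n) : inner ℂ (b j) p = inner ℂ (b j) v := by
      rw [hp, inner_sum]
      simp_rw [inner_smul_right, horth]
      rw [Finset.sum_ite_eq_of_mem' _ _ _ hj]
    have hre (i) : inner ℂ (b i) v * inner ℂ v (b i) = ((‖inner ℂ (b i) v‖ ^ 2 : ℝ) : ℂ) := by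
      rw [← inner_conj_symm v (b i), RCLike.mul_conj]
      norm_cast
    have hvp : inner ℂ v p = ((∑ i ∈ Finset.range n, ‖inner ℂ (b i) v‖ ^ 2 : ℝ) : ℂ) := by
      rw [hp, inner_sum, Complex.ofReal_sum]
      exact Finset.sum_congr rfl fun i _ => by rw [inner_smul_right, hre]
    have hpp : inner ℂ p p = inner ℂ v p := by
      conv_lhs => rw [hp, sum_inner]
      conv_rhs => rw [hp, inner_sum]
      refine Finset.sum_congr rfl fun i hi => ?_
      rw [inner_smul_left, hbp i hi, inner_smul_right, ← inner_conj_symm v (b i), mul_comm]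
    have hpp' : ‖p‖ ^ 2 = ∑ i ∈ Finset.range n, ‖inner ℂ (b i) v‖ ^ 2 := by
      have := congrArg Complex.re (hpp.trans hvp)
      rw [Complex.ofReal_re] at this
      rw [← this]
      exact (inner_self_eq_norm_sq (𝕜 := ℂ) p).symm
    have hvp' : RCLike.re (inner ℂ v p) = ∑ i ∈ Finset.range n, ‖inner ℂ (b i) v‖ ^ 2 := by
      rw [hvp]
      exact Complex.ofReal_re _
    rw [norm_sub_sq (𝕜 := ℂ), hvp', hpp']
    ring

/-- `C₀(Â, H)` has a frame of multipliers, for separable `H`. -/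
theorem exists_isMultiplierFrame [CompleteSpace H] [TopologicalSpace.SeparableSpace H] :
    ∃ β : ℕ → Multiplier A (FreeModule A H), IsMultiplierFrame β := by
  obtain ⟨b, hb, hbn⟩ := exists_orthogonal_seq (H := H)
  refine ⟨fun i => constMultiplier (b i), fun ξ η => ?_⟩
  rw [Metric.tendsto_atTop']
  intro ε hε
  -- A Parseval defect of `η x` below `δ` gives an error of at most `‖ξ‖ * √δ ≤ ε / 2`; the `+ 1`
  -- covers `ξ = 0`.
  set δ : ℝ := (ε / (2 * (‖ξ‖ + 1))) ^ 2 with hδ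
  have hη0 : Tendsto (fun x => ‖η x‖ ^ 2) (cocompact (characterSpace ℂ A)) (𝓝 0) := by
    simpa using! (η.zero_at_infty'.norm.pow 2)
  obtain ⟨N, hN⟩ := eventually_atTop.1 (eventually_forall_sub_le
    (F := fun n x => ∑ i ∈ Finset.range n, ‖inner ℂ (b i) (η x)‖ ^ 2)
    (f := fun x => ‖η x‖ ^ 2) (ε := δ)
    (fun n => continuous_finsetSum _ fun i _ => (continuous_const.inner η.continuous).norm.pow 2)
    (fun n x => by positivity)
    (fun m n hmn x => Finset.sum_le_sum_of_subset_of_nonneg (Finset.range_mono hmn)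
      fun _ _ _ => by positivity)
    (η.continuous.norm.pow 2) hη0 (fun x => (hb (η x)).tendsto_sum_nat) (by positivity))
  refine ⟨N, fun n hn => ?_⟩
  rw [dist_eq_norm]
  refine lt_of_le_of_lt (norm_le_of_forall_apply_le (C := ε / 2) (by positivity) fun x => ?_)
    (half_lt_self hε)
  have h1 : x (∑ i ∈ Finset.range n, star (adjoint (constMultiplier (A := A) (b i)).2 ξ) *
      adjoint (constMultiplier (A := A) (b i)).2 η - inner A ξ η) =
      ∑ i ∈ Finset.range n, inner ℂ (ξ x) (b i) * inner ℂ (b i) (η x) - inner ℂ (ξ x) (η x) := by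
    simp only [map_sub, map_sum, map_mul, apply_star, adjoint_constMultiplier, apply_innerLeft,
      apply_inner]
    congr 1
    refine Finset.sum_congr rfl fun i _ => ?_
    rw [← inner_conj_symm (ξ x)]
    rfl
  refine (congrArg norm h1).trans_le ((norm_sum_inner_mul_inner_sub_inner_le _ _ (hbn n)).trans ?_)
  have h2 : √(‖η x‖ ^ 2 - ∑ i ∈ Finset.range n, ‖inner ℂ (b i) (η x)‖ ^ 2) ≤
      ε / (2 * (‖ξ‖ + 1)) := by
    rw [← Real.sqrt_sq (show 0 ≤ ε / (2 * (‖ξ‖ + 1)) by positivity), ← hδ]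
    refine Real.sqrt_le_sqrt ?_
    have := (abs_le.1 (hN n hn.le x)).1
    linarith
  calc _ ≤ ‖ξ‖ * (ε / (2 * (‖ξ‖ + 1))) := by
        gcongr
        exact ξ.toBCF.norm_coe_le_norm x
    _ ≤ ε / 2 := by
        rw [mul_div_assoc', div_le_div_iff₀ (by positivity) (by positivity)]
        nlinarith [norm_nonneg ξ]

end ExistsFrame

/-! ### The trace as a function on the spectrum, and the equivalence -/

section Trace

open WeakDual GelfandSpectrum

variable {A H : Type*} [NonUnitalCommCStarAlgebra A] [PartialOrder A] [StarOrderedRing A]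
  [NormedAddCommGroup H] [InnerProductSpace ℂ H] [CompleteSpace H]

omit [CompleteSpace H] in
theorem ofReal_re_inner_of_nonneg {T : H →L[ℂ] H} (hT : 0 ≤ T) (v : H) :
    ((RCLike.re (inner ℂ v (T v)) : ℝ) : ℂ) = inner ℂ v (T v) :=
  (RCLike.nonneg_iff_exists_ofReal.1
    (((ContinuousLinearMap.nonneg_iff_isPositive T).1 hT).inner_nonneg_right v)).elim
      fun r hr => by rw [← hr.2]; rfl

/-- The trace norm of the localisation of `t` is computed by any frame of multipliers. -/
theorem IsMultiplierFrame.tsum_eq_traceNorm {β : ℕ → Multiplier A (FreeModule A H)}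
    (hβ : IsMultiplierFrame β) (t : AdjointableOp A (FreeModule A H)) (x : characterSpace ℂ A) :
    ∑' i, ENNReal.ofReal (RCLike.re
      (inner ℂ ((β i).eval x) (localise (absOp t) x ((β i).eval x)))) =
      traceNorm (localise t x) := by
  rw [localise_absOp]
  exact tsum_re_inner_eq_diagonalSum _ (hβ.hasSum x) (CFC.abs_nonneg _)

theorem localise_absOp_nonneg (t : AdjointableOp A (FreeModule A H)) (x : characterSpace ℂ A) :
    0 ≤ localise (absOp t) x := by
  rw [localise_absOp]
  exact CFC.abs_nonneg _

theorem apply_sum_multiplierInner (β : ℕ → Multiplier A (FreeModule A H))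
    (t : AdjointableOp A (FreeModule A H)) (n : ℕ) (c : A) (x : characterSpace ℂ A) :
    x ((∑ i ∈ Finset.range n, multiplierInner (β i) (absOp t)) c) =
      x c * ((∑ i ∈ Finset.range n, RCLike.re
        (inner ℂ ((β i).eval x) (localise (absOp t) x ((β i).eval x))) : ℝ) : ℂ) := by
  rw [sum_apply, map_sum, Complex.ofReal_sum, Finset.mul_sum]
  refine Finset.sum_congr rfl fun i _ => ?_
  rw [apply_multiplierInner, ofReal_re_inner_of_nonneg (localise_absOp_nonneg t x)]

/-- Applying the norm-convergent series to some `c` with `x c = 1` and evaluating at `x` leaves the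
scalar series for the trace of `|t_x|`, with sum `x a`. -/
theorem IsMultiplierFrame.traceNorm_eq_of_hasTrace {β : ℕ → Multiplier A (FreeModule A H)}
    (hβ : IsMultiplierFrame β) {t : AdjointableOp A (FreeModule A H)} {a : A}
    (ha : HasTrace β (absOp t) a) (x : characterSpace ℂ A) :
    traceNorm (localise t x) = ENNReal.ofReal (x a).re := by
  obtain ⟨c, hc⟩ := exists_apply_eq_one x
  have h := (Complex.continuous_re.tendsto _).comp (((map_continuous x).tendsto _).comp
    (((ContinuousLinearMap.apply ℂ A c).continuous.tendsto _).comp ha))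
  have h1 : x (ContinuousLinearMap.apply ℂ A c (ContinuousLinearMap.mul ℂ A a)) = x a := by
    change x (a * c) = x a
    rw [map_mul, hc, mul_one]
  rw [h1] at h
  have h0 (i) := nonneg_re_inner (localise_absOp_nonneg t x) ((β i).eval x)
  have hsum : HasSum (fun i => RCLike.re
      (inner ℂ ((β i).eval x) (localise (absOp t) x ((β i).eval x)))) (x a).re := by
    rw [hasSum_iff_tendsto_nat_of_nonneg h0]
    refine h.congr fun n => ?_
    have := apply_sum_multiplierInner β t n c x
    rw [hc, one_mul] at this
    exact (congrArg Complex.re this).trans (Complex.ofReal_re _)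
  rw [← hβ.tsum_eq_traceNorm, ← ENNReal.ofReal_tsum_of_nonneg h0 hsum.summable, hsum.tsum_eq]

theorem IsMultiplierFrame.traceDefined_absOp_iff {β : ℕ → Multiplier A (FreeModule A H)}
    (hβ : IsMultiplierFrame β) (t : AdjointableOp A (FreeModule A H)) :
    TraceDefined β (absOp t) ↔ IsC0TraceClass (localise t) := by
  constructor
  · rintro ⟨a, ha⟩
    have h := hβ.traceNorm_eq_of_hasTrace ha
    have hne (x) : traceNorm (localise t x) ≠ ∞ := by
      rw [h]
      exact ENNReal.ofReal_ne_top
    refine ⟨hne, fun x => ?_, ?_⟩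
    -- The strong convergence hypotheses hold for every adjointable operator, here `t` and `absOp
    -- t`. Only convergence of the trace norms uses `a`.
    · refine tendsto_traceNorm_sub (hne x) (fun v => (continuous_localise_apply t v).tendsto x)
        (fun v => ?_) ?_
      · simp_rw [← localise_absOp]
        exact (continuous_localise_apply (absOp t) v).tendsto x
      · simp_rw [h]
        exact (ENNReal.continuous_ofReal.comp
          (Complex.continuous_re.comp (continuous_apply a))).tendsto x
    · simp_rw [h]
      have h1 := (ENNReal.continuous_ofReal.tendsto _).comp
        ((Complex.continuous_re.tendsto _).comp (tendsto_apply_cocompact a))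
      simpa using! h1
  · intro ht
    -- The candidate for the trace is the element of `A` whose Gelfand transform is the trace norm.
    set f : characterSpace ℂ A → ℝ := fun x => (traceNorm (localise t x)).toReal with hf
    have hfc : Continuous f := continuous_iff_continuousAt.2 fun x =>
      (ENNReal.tendsto_toReal (ht.traceNorm_ne_top x)).comp
        (tendsto_traceNorm_of_tendsto_sub (ht.continuous x))
    have hf0 : Tendsto f (cocompact _) (𝓝 0) := by
      simpa using! (ENNReal.tendsto_toReal ENNReal.zero_ne_top).comp ht.zero_at_infty
    obtain ⟨a, ha⟩ := exists_apply_eq_ofReal hfc hf0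
    refine ⟨a, ?_⟩
    have h0 (x) (i) := nonneg_re_inner (localise_absOp_nonneg t x) ((β i).eval x)
    have hsum (x) : HasSum (fun i => RCLike.re
        (inner ℂ ((β i).eval x) (localise (absOp t) x ((β i).eval x)))) (f x) := by
      have h1 := hβ.tsum_eq_traceNorm t x
      have h2 := ENNReal.hasSum_toReal (h1.trans_ne (ht.traceNorm_ne_top x))
      simp_rw [ENNReal.toReal_ofReal (h0 x _)] at h2
      have h3 : f x = ∑' i, RCLike.re
          (inner ℂ ((β i).eval x) (localise (absOp t) x ((β i).eval x))) := by
        rw [hf]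
        simp only
        rw [← h1, ENNReal.tsum_toReal_eq fun _ => ENNReal.ofReal_ne_top]
        exact tsum_congr fun i => ENNReal.toReal_ofReal (h0 x i)
      rwa [h3]
    refine Metric.tendsto_atTop'.2 fun ε hε => ?_
    obtain ⟨N, hN⟩ := eventually_atTop.1 (eventually_forall_sub_le
      (F := fun n x => ∑ i ∈ Finset.range n, RCLike.re
        (inner ℂ ((β i).eval x) (localise (absOp t) x ((β i).eval x))))
      (fun n => continuous_finsetSum _ fun i _ =>
        RCLike.continuous_re.comp (continuous_inner_localise (β i) (absOp t)))
      (fun n x => Finset.sum_nonneg fun i _ => h0 x i)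
      (fun m n hmn x => Finset.sum_le_sum_of_subset_of_nonneg (Finset.range_mono hmn)
        fun i _ _ => h0 x i)
      hfc hf0 (fun x => (hsum x).tendsto_sum_nat) (half_pos hε))
    refine ⟨N, fun n hn => ?_⟩
    rw [dist_eq_norm]
    -- The difference acts on `A` as multiplication by a function on the spectrum, so the uniform
    -- bound from Dini's theorem bounds its operator norm.
    refine lt_of_le_of_lt (ContinuousLinearMap.opNorm_le_bound _ (half_pos hε).le fun c => ?_)
      (half_lt_self hε)
    refine norm_le_of_forall_apply_le (by positivity) fun x => ?_
    have h1 : x ((∑ i ∈ Finset.range n, multiplierInner (β i) (absOp t) -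
        ContinuousLinearMap.mul ℂ A a) c) = x c * ((∑ i ∈ Finset.range n, RCLike.re
        (inner ℂ ((β i).eval x) (localise (absOp t) x ((β i).eval x))) - f x : ℝ) : ℂ) := by
      rw [sub_apply, map_sub, apply_sum_multiplierInner]
      have : x (ContinuousLinearMap.mul ℂ A a c) = x c * (f x : ℂ) := by
        change x (a * c) = _
        rw [map_mul, ha, mul_comm]
      rw [this, Complex.ofReal_sub, mul_sub]
    rw [h1, norm_mul, mul_comm, Complex.norm_real]
    exact mul_le_mul (hN n hn.le x) (norm_apply_le x c) (norm_nonneg _) (half_pos hε).le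

end Trace

end HilbertModule

theorem theorem3p1 {A H : Type*} [NonUnitalCommCStarAlgebra A] [PartialOrder A]
    [StarOrderedRing A] [NormedAddCommGroup H] [InnerProductSpace ℂ H] [CompleteSpace H]
    [TopologicalSpace.SeparableSpace H]
    (t : HilbertModule.AdjointableOp A (HilbertModule.FreeModule A H)) :
    (HilbertModule.IsTraceClass t ↔ HilbertModule.IsC0TraceClass (HilbertModule.localise t)) ∧
      ∀ β : ℕ → HilbertModule.Multiplier A (HilbertModule.FreeModule A H),
        HilbertModule.IsMultiplierFrame β →
          (HilbertModule.TraceDefined β (HilbertModule.absOp t) ↔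
            HilbertModule.IsC0TraceClass (HilbertModule.localise t)) := by
  refine ⟨⟨fun ⟨β, hβ, h⟩ => (hβ.traceDefined_absOp_iff t).1 h, fun h => ?_⟩,
    fun β hβ => hβ.traceDefined_absOp_iff t⟩
  -- Only this implication needs a frame to exist, and with it the separability of `H`.
  obtain ⟨β, hβ⟩ := HilbertModule.exists_isMultiplierFrame (A := A) (H := H)
  exact ⟨β, hβ, (hβ.traceDefined_absOp_iff t).2 h⟩
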